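/- Define polynomials $m_d=m_d(u_0,u_1,\dots,u_{2d})$, $d\ge 0$, by the requirement that the series $b(\lambda)=1+\sum_{d\ge 0}(2d+1)!!\,m_d\,\lambda^{-d-1}$ satisfies $$b\,\partial^2(b)-\tfrac12\,\partial(b)^2-2(\lambda-2u_0)\,b^2=-2\lambda,\qquad \partial:=\sum_{i\ge 0}u_{i+1}\frac{\partial}{\partial u_i}.$$ (For example $m_0=u_0$, $m_1=\frac12u_0^2+\frac1{12}u_2$.) For $d\ge1$, the $d$-th equation of the Painlevé II hierarchy with parameter $\alpha_d=\frac12$ is $$2^{2d-1}(2d-1)!!\,(\partial_X+2V)\Bigl(m_{d-1}\bigl(\tfrac{V_X-V^2}{2},\tfrac{(V_X-V^2)_X}{2},\dots\bigr)\Bigr)-VX-\tfrac12=0 .$$ **Theorem.** For each $d\ge 1$ this equation has a unique formal solution of the form $$V(X)=-\sum_{n=0}^{\infty}\frac{v_{d,n}}{X^{(2d+1)n+1}},\qquad v_{d,n}\in\mathbb C,\quad v_{d,0}=\tfrac12,$$ and its coefficients satisfy $$v_{d,n}\;\sim\;\frac1\pi\,\frac{((2d+1)n-1)!}{(2d+1)^{n-1}\,(n-1)!}\qquad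 (n\to\infty).$$ -/

import Mathlib

open scoped Nat

noncomputable section

namespace PainleveII

/-- Differential polynomials in the jet variables `u₀, u₁, u₂, …`. -/
abbrev DiffPoly : Type := MvPolynomial ℕ ℂ

/-- The derivation `∂ = ∑ u_{i+1} ∂/∂u_i`. -/
def del : Derivation ℂ DiffPoly DiffPoly :=
  MvPolynomial.mkDerivation ℂ fun i => MvPolynomial.X (i + 1)

/-- The coefficient of `λ^{-k}` in `b(λ)`: the defining equation
`b ∂²(b) - ½ ∂(b)² - 2 (λ - 2 u₀) b² = -2 λ`, `b = 1 + O(λ⁻¹)`, solved order by order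
(see `isGeneratingFamily_iff` below). -/
def bCoeff : ℕ → DiffPoly
  | 0 => 1
  | k + 1 =>
    MvPolynomial.C (1 / 4) *
      ((∑ i : Fin (k + 1),
          (bCoeff i * del (del (bCoeff (k - i)))
            - MvPolynomial.C (1 / 2) * (del (bCoeff i) * del (bCoeff (k - i)))
            + 4 * MvPolynomial.X 0 * (bCoeff i * bCoeff (k - i))))
        - 2 * ∑ i : Fin k, bCoeff (i + 1) * bCoeff (k - i))

/-- The polynomials `m_d`, given by `b(λ) = 1 + ∑_{d ≥ 0} (2d+1)!! m_d λ^{-(d+1)}`. -/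
def m (d : ℕ) : DiffPoly :=
  MvPolynomial.C (1 / ((2 * d + 1)‼ : ℂ)) * bCoeff (d + 1)

/-- The series `1 + ∑_{d ≥ 0} (2d+1)!! p_d z^{d+1}` in `z = λ⁻¹`, for a family `p`. -/
def genSeries (p : ℕ → DiffPoly) : PowerSeries DiffPoly :=
  PowerSeries.mk fun k =>
    match k with
    | 0 => 1
    | d + 1 => MvPolynomial.C ((2 * d + 1)‼ : ℂ) * p d

/-- `∂` acting coefficientwise on series in `z = λ⁻¹`. -/
def delSeries (F : PowerSeries DiffPoly) : PowerSeries DiffPoly :=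
  PowerSeries.mk fun k => del (PowerSeries.coeff k F)

/-- The equation `b ∂²(b) - ½ ∂(b)² - 2 (λ - 2 u₀) b² = -2 λ` for the generating series `b` of the
family `p`, written in `z = λ⁻¹` after multiplication of both sides by `z`. -/
def IsGeneratingFamily (p : ℕ → DiffPoly) : Prop :=
  let b := genSeries p
  let z : PowerSeries DiffPoly := PowerSeries.X
  z * (b * delSeries (delSeries b)
      - PowerSeries.C (MvPolynomial.C (1 / 2)) * delSeries b ^ 2)
    - 2 * (1 - 2 * PowerSeries.C (MvPolynomial.X 0) * z) * b ^ 2 = -2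

theorem bCoeff_succ (k : ℕ) : bCoeff (k + 1) =
    MvPolynomial.C (1 / 4) *
      ((∑ i ∈ Finset.range (k + 1),
          (bCoeff i * del (del (bCoeff (k - i)))
            - MvPolynomial.C (1 / 2) * (del (bCoeff i) * del (bCoeff (k - i)))
            + 4 * MvPolynomial.X 0 * (bCoeff i * bCoeff (k - i))))
        - 2 * ∑ i ∈ Finset.range k, bCoeff (i + 1) * bCoeff (k - i)) := by
  rw [bCoeff, Finset.sum_range, Finset.sum_range]

theorem four_inv_cancel : (MvPolynomial.C (1 / 4) : DiffPoly) * 4 = 1 := by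
  have h : (4 : DiffPoly) = MvPolynomial.C 4 := (map_ofNat MvPolynomial.C 4).symm
  rw [h, ← MvPolynomial.C_mul]; norm_num

/-- A series `b` with constant term `1` solves the equation exactly if its coefficients satisfy
the recursion of `bCoeff`. -/
theorem series_eq_iff (b : PowerSeries DiffPoly) (h0 : PowerSeries.coeff 0 b = 1) :
    (PowerSeries.X * (b * delSeries (delSeries b)
      - PowerSeries.C (MvPolynomial.C (1 / 2)) * delSeries b ^ 2)
    - 2 * (1 - 2 * PowerSeries.C (MvPolynomial.X 0) * PowerSeries.X) * b ^ 2 = -2) ↔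
    ∀ k, PowerSeries.coeff k b = bCoeff k := by
  have key : ∀ k, PowerSeries.coeff (k + 1)
      (PowerSeries.X * (b * delSeries (delSeries b)
        - PowerSeries.C (MvPolynomial.C (1 / 2)) * delSeries b ^ 2)
      - 2 * (1 - 2 * PowerSeries.C (MvPolynomial.X 0) * PowerSeries.X) * b ^ 2) =
      (∑ i ∈ Finset.range (k + 1),
          (PowerSeries.coeff i b * del (del (PowerSeries.coeff (k - i) b))
            - MvPolynomial.C (1 / 2)
              * (del (PowerSeries.coeff i b) * del (PowerSeries.coeff (k - i) b))
            + 4 * MvPolynomial.X 0 * (PowerSeries.coeff i b * PowerSeries.coeff (k - i) b)))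
        - 2 * (∑ i ∈ Finset.range k, PowerSeries.coeff (i + 1) b * PowerSeries.coeff (k - i) b)
        - 4 * PowerSeries.coeff (k + 1) b := by
    intro k
    have e : PowerSeries.X * (b * delSeries (delSeries b)
        - PowerSeries.C (MvPolynomial.C (1 / 2)) * delSeries b ^ 2)
      - 2 * (1 - 2 * PowerSeries.C (MvPolynomial.X 0) * PowerSeries.X) * b ^ 2 =
      PowerSeries.X * (b * delSeries (delSeries b)
        - PowerSeries.C (MvPolynomial.C (1 / 2)) * (delSeries b * delSeries b)
        + PowerSeries.C (4 * MvPolynomial.X 0) * (b * b))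
      - PowerSeries.C 2 * (b * b) := by
      have h2 : (PowerSeries.C (2 : DiffPoly)) = 2 := map_ofNat PowerSeries.C 2
      have h4 : (PowerSeries.C (4 : DiffPoly)) = 4 := map_ofNat PowerSeries.C 4
      rw [map_mul, h2, h4]; ring
    rw [e, map_sub, PowerSeries.coeff_succ_X_mul, PowerSeries.coeff_C_mul, map_add, map_sub,
      PowerSeries.coeff_C_mul, PowerSeries.coeff_C_mul]
    simp only [PowerSeries.coeff_mul, delSeries, PowerSeries.coeff_mk]
    simp only [Finset.Nat.sum_antidiagonal_eq_sum_range_succ_mk]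
    rw [Finset.sum_range_succ' _ (k + 1),
      Finset.sum_range_succ (fun i => PowerSeries.coeff (i + 1) b * _) k, Finset.sum_add_distrib,
      Finset.sum_sub_distrib, Finset.mul_sum, Finset.mul_sum]
    simp only [Nat.add_sub_add_right, Nat.sub_self, Nat.sub_zero, h0]
    ring
  have key0 : PowerSeries.coeff 0
      (PowerSeries.X * (b * delSeries (delSeries b)
        - PowerSeries.C (MvPolynomial.C (1 / 2)) * delSeries b ^ 2)
      - 2 * (1 - 2 * PowerSeries.C (MvPolynomial.X 0) * PowerSeries.X) * b ^ 2) = -2 := by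
    have h0' : PowerSeries.constantCoeff b = 1 := by simpa using h0
    have h2 : PowerSeries.constantCoeff (2 : PowerSeries DiffPoly) = 2 := map_ofNat _ 2
    simp [h0', h2]
  have m2 : ∀ k, PowerSeries.coeff (k + 1) (-2 : PowerSeries DiffPoly) = 0 := by
    intro k
    have h2 : (-2 : PowerSeries DiffPoly) = PowerSeries.C (-2 : DiffPoly) := by
      rw [map_neg, map_ofNat]
    rw [h2, PowerSeries.coeff_C]; simp
  constructor
  · intro h k
    induction k using Nat.strong_induction_on with
    | _ k ih =>
      cases k with
      | zero => rw [h0, bCoeff]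
      | succ k =>
        have hk := key k
        rw [h, m2] at hk
        rw [bCoeff_succ]
        have s1 : ∀ i ∈ Finset.range (k + 1), PowerSeries.coeff i b = bCoeff i ∧
            PowerSeries.coeff (k - i) b = bCoeff (k - i) := fun i hi => by
          have := Finset.mem_range.1 hi
          exact ⟨ih _ (by omega), ih _ (by omega)⟩
        have s2 : ∀ i ∈ Finset.range k, PowerSeries.coeff (i + 1) b = bCoeff (i + 1) ∧
            PowerSeries.coeff (k - i) b = bCoeff (k - i) := fun i hi => by
          have := Finset.mem_range.1 hi
          exact ⟨ih _ (by omega), ih _ (by omega)⟩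
        rw [Finset.sum_congr rfl fun i hi => by rw [(s1 i hi).1, (s1 i hi).2],
          Finset.sum_congr (s₁ := Finset.range k) rfl
            fun i hi => by rw [(s2 i hi).1, (s2 i hi).2]] at hk
        linear_combination MvPolynomial.C (1 / 4) * hk
          - PowerSeries.coeff (k + 1) b * four_inv_cancel
  · intro h
    ext1 k
    cases k with
    | zero =>
      rw [key0, PowerSeries.coeff_zero_eq_constantCoeff_apply, map_neg, map_ofNat]
    | succ k =>
      rw [key, m2]
      simp only [h]
      rw [bCoeff_succ k]
      generalize (∑ i ∈ Finset.range (k + 1), _ : DiffPoly) = S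
      generalize (∑ i ∈ Finset.range k, _ : DiffPoly) = T
      linear_combination (-(S - 2 * T)) * four_inv_cancel

/-- The family `m` is the unique one whose generating series satisfies the defining equation. -/
theorem isGeneratingFamily_iff (p : ℕ → DiffPoly) : IsGeneratingFamily p ↔ p = m := by
  have hC : ∀ d : ℕ, (MvPolynomial.C ((2 * d + 1)‼ : ℂ) : DiffPoly) *
      MvPolynomial.C (1 / ((2 * d + 1)‼ : ℂ)) = 1 := fun d => by
    have : ((2 * d + 1)‼ : ℂ) ≠ 0 := by exact_mod_cast (Nat.doubleFactorial_pos _).ne'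
    rw [← MvPolynomial.C_mul, mul_one_div_cancel this, MvPolynomial.C_1]
  unfold IsGeneratingFamily
  rw [series_eq_iff _ (by simp [genSeries])]
  constructor
  · intro h
    funext d
    have hd := h (d + 1)
    simp only [genSeries, PowerSeries.coeff_mk] at hd
    rw [m, ← hd, ← mul_assoc, mul_comm (MvPolynomial.C _) (MvPolynomial.C _), hC, one_mul]
  · rintro rfl k
    cases k with
    | zero => simp [genSeries, bCoeff]
    | succ d =>
      simp only [genSeries, PowerSeries.coeff_mk]
      rw [m, ← mul_assoc, hC, one_mul]

/-- Formal Laurent series in `X⁻¹` over `ℂ`: the coefficient at `k` is that of `X^{-k}`. -/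
abbrev InvSeries : Type := LaurentSeries ℂ

/-- The element `X` of the ring of Laurent series in `X⁻¹`. -/
def varX : InvSeries := HahnSeries.single (-1) 1

/-- The derivative `∂_X`; with `z = X⁻¹` it is `-z² d/dz`. -/
def dX (F : InvSeries) : InvSeries :=
  -(HahnSeries.single 2 1 * LaurentSeries.derivative ℂ F)

/-- `p(f, f_X, f_XX, …)` for a differential polynomial `p`. -/
def evalJet (p : DiffPoly) (f : InvSeries) : InvSeries :=
  MvPolynomial.eval₂ HahnSeries.C (fun i => dX^[i] f) p

/-- The left-hand side of the `d`-th equation of the Painlevé II hierarchy with parameter `α`: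
`2^{2d-1} (2d-1)!! (∂_X + 2V) (m_{d-1}((V_X-V²)/2, (V_X-V²)_X/2, …)) - V X - α`, for `d ≥ 1`. -/
def p2Lhs (d : ℕ) (α : ℂ) (V : InvSeries) : InvSeries :=
  let M : InvSeries := evalJet (m (d - 1)) (HahnSeries.C (1 / 2) * (dX V - V ^ 2))
  HahnSeries.C ((2 : ℂ) ^ (2 * d - 1) * ((2 * d - 1)‼ : ℂ)) * (dX M + 2 * V * M)
    - V * varX - HahnSeries.C α

/-- The series `-∑_{n ≥ 0} v_n X^{-((2d+1)n+1)}`, i.e. `-z ∑ v_n (z^{2d+1})^n` with `z = X⁻¹`. -/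
def ansatz (d : ℕ) (v : ℕ → ℂ) : InvSeries :=
  HahnSeries.ofPowerSeries ℤ ℂ
    (-(PowerSeries.X * PowerSeries.expand (2 * d + 1) (Nat.succ_ne_zero _) (PowerSeries.mk v)))

/-- `v` is the coefficient sequence of a formal solution
`V(X) = -∑ v_n X^{-((2d+1)n+1)}`, `v_0 = 1/2`, of the `d`-th Painlevé II equation with
`α_d = 1/2`. -/
def IsFormalSolution (d : ℕ) (v : ℕ → ℂ) : Prop :=
  v 0 = 1 / 2 ∧ p2Lhs d (1 / 2) (ansatz d v) = 0

end PainleveII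

end

/-!
The coefficients `b_k` of the resolvent `b(λ)` satisfy the Lenard recursion
`4 b_{k+1}' = b_k''' + 8 u b_k' + 4 u' b_k`. With `u = (V_X - V²)/2` the Painlevé II equation with
`α = 1/2` becomes the linear equation `(∂_X + 2 V) (X - 4^d b_d) = 0`. Since `V = -f'/(2f)` makes
the first integral `2 f f'' - f'^2 + 8 u f²` of the Lenard operator vanish, this holds if and only
if `u` is the potential `1/(8 X²) + ⋯` with `4^d b_{d+1}' = 2 u + X u'` and `V` is the logarithmic
derivative belonging to `f = X - 4^d b_d`. Hence the formal solution exists, is unique, and its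
coefficients `v_n` satisfy a linear recursion in terms of those of `b_d`.

For this `u` write `b_k = ∑ β_{k,n} X^{-((2d+1)n + 2k)}`. The Lenard recursion expresses
`β_{k+1,n}` by the rows below `k + 1`, and the merging identity
`2k b_k + X b_k' = 4^d ∑_{j ≤ d} W(b_j, b_{k+d-j})`, with `W` the Wronskian, expresses `β_{k,n+1}`
by `β_{k+d,n}` plus products. After division by their expected size, the `β_{k,n}` increase with
`k`; at `n = 0` they are partial Wallis products and tend to `2/π`, and trading one unit of `n` for
`d` units of `k` costs `O((n+k)⁻²)`. Applied `n` times to `β_{d,n}` this costs `O(n⁻¹)`, so the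
normalized `β_{d,n}` tends to `2/π`, and the inhomogeneous term dominates the recursion for `v_n`.
-/

noncomputable section

namespace PainleveII

section DifferentialRing

variable {R A : Type*} [CommRing R] [CommRing A] [Algebra R A] (D : Derivation R A A)

/-- The Lenard operator `D³ + 8 u D + 4 (D u)` of the KdV hierarchy. -/
def lenardOp (u : A) : A →ₗ[R] A :=
  (D : A →ₗ[R] A) ∘ₗ (D : A →ₗ[R] A) ∘ₗ (D : A →ₗ[R] A)
    + 8 • LinearMap.mulLeft R u ∘ₗ (D : A →ₗ[R] A) + 4 • LinearMap.mulLeft R (D u)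

theorem lenardOp_apply (u f : A) :
    lenardOp D u f = D (D (D f)) + 8 • (u * D f) + 4 • (D u * f) := rfl

/-- The quadratic first integral of the Lenard operator: its derivative is `2 f · lenardOp D u f`,
see `map_lenardForm`. -/
def lenardForm (u f : A) : A := 2 • (f * D (D f)) - D f ^ 2 + 8 • (u * f ^ 2)

theorem map_lenardForm (u f : A) : D (lenardForm D u f) = 2 • (f * lenardOp D u f) := by
  simp only [lenardForm, lenardOp_apply, map_add, map_sub, map_nsmul, Derivation.leibniz,
    Derivation.leibniz_pow, smul_eq_mul]
  ring

/-- The Riccati substitution `V = -D f / (2 f)` linearises the potential. -/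
theorem lenardForm_of_riccati {V f : A} (hf : D f + 2 • (V * f) = 0) (u : A) :
    lenardForm D u f = 4 • (f ^ 2 * (2 • u - (D V - V ^ 2))) := by
  have hDf : D f = -(2 • (V * f)) := eq_neg_of_add_eq_zero_left hf
  have hDDf : D (D f) = -(2 • (V * D f + f * D V)) := by
    conv_lhs => rw [hDf]
    simp only [map_neg, map_nsmul, Derivation.leibniz, smul_eq_mul]
  rw [lenardForm, hDDf, hDf]
  ring

/-- The Wronskian `f (D g) - (D f) g`. -/
def wronskian (f g : A) : A := f * D g - D f * g

theorem wronskian_swap (f g : A) : wronskian D g f = -wronskian D f g := by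
  simp only [wronskian]
  ring

theorem lenardOp_wronskian (u f g : A) :
    lenardOp D u (wronskian D f g) = f * D (lenardOp D u g) + 2 • (D f * lenardOp D u g)
      - (g * D (lenardOp D u f) + 2 • (D g * lenardOp D u f)) := by
  simp only [wronskian, lenardOp_apply, map_add, map_sub, map_nsmul, Derivation.leibniz,
    smul_eq_mul]
  ring

theorem lenardOp_mul_map {x : A} (hx : D x = 1) (u f : A) :
    lenardOp D u (x * D f) = x * D (lenardOp D u f) + 3 • lenardOp D u f
      - 8 • ((2 • u + x * D u) * D f) - 4 • (D (2 • u + x * D u) * f) := by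
  simp only [lenardOp_apply, map_add, map_nsmul, Derivation.leibniz, smul_eq_mul, hx,
    mul_one]
  ring

/-- Sequences generated from `1` by the Lenard recursion `4 D B_{k+1} = lenardOp D u B_k`, such as
the coefficients of the resolvent `b(λ)` of the potential `u`. -/
structure IsLenardSequence (u : A) (B : ℕ → A) : Prop where
  zero : B 0 = 1
  succ (k : ℕ) : 4 • D (B (k + 1)) = lenardOp D u (B k)

/-- The sum of the Wronskians of `B_j` and `B_{k+d-j}` for `j ≤ d`. -/
def wronskianSum (B : ℕ → A) (d k : ℕ) : A :=
  ∑ j ∈ Finset.range (d + 1), wronskian D (B j) (B (k + d - j))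

theorem wronskianSum_zero [IsAddTorsionFree A] (B : ℕ → A) (d : ℕ) :
    wronskianSum D B d 0 = 0 := by
  refine self_eq_neg.1 ?_
  conv_lhs => rw [wronskianSum, ← Finset.sum_range_reflect]
  rw [wronskianSum, ← Finset.sum_neg_distrib]
  refine Finset.sum_congr rfl fun j hj => ?_
  rw [wronskian_swap, show d + 1 - 1 - j = 0 + d - j by omega,
    show 0 + d - (0 + d - j) = j by grind]

variable {D}

theorem IsLenardSequence.lenardOp_wronskianSum {u : A} {B : ℕ → A} (hB : IsLenardSequence D u B)
    (d k : ℕ) :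
    lenardOp D u (wronskianSum D B d k) = 4 • D (wronskianSum D B d (k + 1))
      - 4 • (D (D (B (d + 1))) * B k + 2 • (D (B (d + 1)) * D (B k))) := by
  let H : ℕ → A := fun j => D (D (B j)) * B (k + d + 1 - j) + 2 • (D (B j) * D (B (k + d + 1 - j)))
  have telescope : ∀ j ∈ Finset.range (d + 1),
      lenardOp D u (wronskian D (B j) (B (k + d - j))) =
        4 • D (wronskian D (B j) (B (k + 1 + d - j))) + 4 • (H j - H (j + 1)) := by
    intro j hj
    have hj := Finset.mem_range.1 hj
    rw [lenardOp_wronskian, ← hB.succ, ← hB.succ]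
    simp only [H, wronskian, map_sub, map_nsmul, Derivation.leibniz, smul_eq_mul,
      show k + 1 + d - j = k + d - j + 1 by omega,
      show k + d + 1 - j = k + d - j + 1 by omega, show k + d + 1 - (j + 1) = k + d - j by omega]
    ring
  rw [wronskianSum, wronskianSum, map_sum, Finset.sum_congr rfl telescope, Finset.sum_add_distrib,
    map_sum, Finset.smul_sum, ← Finset.smul_sum (f := fun j => H j - H (j + 1)),
    Finset.sum_range_sub']
  simp only [H, hB.zero, Derivation.map_one_eq_zero, map_zero,
    show k + d + 1 - (d + 1) = k by omega]
  ring

variable (D) in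
/-- The difference of the two sides of the merging identity
`2k B_k + x (D B_k) = 4 ^ d ∑_{j ≤ d} wronskian (B_j) (B_{k+d-j})`. -/
def mergingDefect (x : A) (B : ℕ → A) (d k : ℕ) : A :=
  (2 * k) • B k + x * D (B k) - 4 ^ d • wronskianSum D B d k

theorem mergingDefect_zero [IsAddTorsionFree A] {x : A} {B : ℕ → A} (hB : B 0 = 1) (d : ℕ) :
    mergingDefect D x B d 0 = 0 := by
  simp [mergingDefect, wronskianSum_zero, hB]

/-- Since `mergingDefect D x B d 0 = 0`, all defects vanish as soon as `D` is injective on them. -/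
theorem IsLenardSequence.lenardOp_mergingDefect {u x : A} {B : ℕ → A}
    (hB : IsLenardSequence D u B) (hx : D x = 1) {d : ℕ}
    (hu : 4 ^ d • D (B (d + 1)) = 2 • u + x * D u) (k : ℕ) :
    lenardOp D u (mergingDefect D x B d k) = 4 • D (mergingDefect D x B d (k + 1)) := by
  rw [mergingDefect, map_sub, map_add, map_nsmul, map_nsmul, lenardOp_mul_map D hx, ← hu,
    hB.lenardOp_wronskianSum, ← hB.succ]
  simp only [mergingDefect, map_sub, map_add, map_nsmul, Derivation.leibniz, smul_eq_mul, hx]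
  ring

end DifferentialRing

/-! ### The Lenard recursion for `bCoeff` -/

theorem coeff_delSeries (F : PowerSeries DiffPoly) (k : ℕ) :
    PowerSeries.coeff k (delSeries F) = del (PowerSeries.coeff k F) :=
  PowerSeries.coeff_mk _ _

theorem delSeries_mul (F G : PowerSeries DiffPoly) :
    delSeries (F * G) = F * delSeries G + G * delSeries F := by
  ext1 k
  rw [mul_comm G]
  simp only [coeff_delSeries, map_add, PowerSeries.coeff_mul, map_sum, Derivation.leibniz,
    smul_eq_mul, ← Finset.sum_add_distrib]
  exact Finset.sum_congr rfl fun _ _ => by ring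

/-- `delSeries` as a derivation. -/
def delSeriesDer : Derivation ℂ (PowerSeries DiffPoly) (PowerSeries DiffPoly) :=
  Derivation.mk'
    { toFun := delSeries
      map_add' := fun F G => by ext1 k; simp only [coeff_delSeries, map_add]
      map_smul' := fun a F => by ext1 k; simp [coeff_delSeries] }
    delSeries_mul

theorem delSeriesDer_apply (F : PowerSeries DiffPoly) : delSeriesDer F = delSeries F := rfl

theorem coeff_delSeriesDer (F : PowerSeries DiffPoly) (k : ℕ) :
    PowerSeries.coeff k (delSeriesDer F) = del (PowerSeries.coeff k F) :=
  coeff_delSeries F k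

theorem delSeriesDer_C (p : DiffPoly) :
    delSeriesDer (PowerSeries.C p) = PowerSeries.C (del p) := by
  ext1 k
  rw [coeff_delSeriesDer, PowerSeries.coeff_C, PowerSeries.coeff_C, apply_ite del, map_zero]

theorem delSeriesDer_X : delSeriesDer PowerSeries.X = 0 := by
  ext1 k
  rw [coeff_delSeriesDer, PowerSeries.coeff_X, apply_ite del, map_zero,
    Derivation.map_one_eq_zero, ite_self, map_zero]

theorem coeff_lenardOp_delSeriesDer (p : DiffPoly) (F : PowerSeries DiffPoly) (k : ℕ) :
    PowerSeries.coeff k (lenardOp delSeriesDer (PowerSeries.C p) F) =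
      lenardOp del p (PowerSeries.coeff k F) := by
  simp only [lenardOp_apply, delSeriesDer_C, map_add, map_nsmul, PowerSeries.coeff_C_mul,
    coeff_delSeriesDer]

/-- The series `b(λ)` in `z = λ⁻¹`. -/
def bSeries : PowerSeries DiffPoly := PowerSeries.mk bCoeff

theorem coeff_bSeries (k : ℕ) : PowerSeries.coeff k bSeries = bCoeff k :=
  PowerSeries.coeff_mk _ _

theorem bCoeff_zero : bCoeff 0 = 1 := by rw [bCoeff]

theorem bSeries_ne_zero : bSeries ≠ 0 := fun h => by
  simpa [h, bCoeff_zero] using coeff_bSeries 0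

/-- Twice the defining equation of `b(λ)`. -/
theorem X_mul_lenardForm_bSeries :
    PowerSeries.X * lenardForm delSeriesDer (PowerSeries.C (MvPolynomial.X 0)) bSeries =
      4 • (bSeries ^ 2 - 1) := by
  have equation := (series_eq_iff bSeries ((coeff_bSeries 0).trans bCoeff_zero)).2 coeff_bSeries
  have half : (2 : PowerSeries DiffPoly) * PowerSeries.C (MvPolynomial.C (1 / 2)) = 1 := by
    rw [← map_ofNat PowerSeries.C, ← map_ofNat MvPolynomial.C, ← map_mul, ← map_mul]
    norm_num
  simp only [← delSeriesDer_apply] at equation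
  rw [lenardForm]
  linear_combination 2 * equation + PowerSeries.X * delSeriesDer bSeries ^ 2 * half

theorem X_mul_lenardOp_bSeries :
    PowerSeries.X * lenardOp delSeriesDer (PowerSeries.C (MvPolynomial.X 0)) bSeries =
      4 • delSeriesDer bSeries := by
  have h := congrArg delSeriesDer X_mul_lenardForm_bSeries
  rw [Derivation.leibniz, map_lenardForm, delSeriesDer_X, map_nsmul, map_sub,
    Derivation.leibniz_pow, Derivation.map_one_eq_zero] at h
  simp only [smul_eq_mul] at h
  have := algebraRat.charZero (PowerSeries DiffPoly)
  refine mul_left_cancel₀ (mul_ne_zero (two_ne_zero' (PowerSeries DiffPoly)) bSeries_ne_zero) ?_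
  linear_combination h

theorem isLenardSequence_bCoeff : IsLenardSequence del (MvPolynomial.X 0) bCoeff where
  zero := bCoeff_zero
  succ k := by
    have h := congrArg (PowerSeries.coeff (k + 1)) X_mul_lenardOp_bSeries
    rw [PowerSeries.coeff_succ_X_mul, coeff_lenardOp_delSeriesDer, map_nsmul, coeff_delSeriesDer,
      coeff_bSeries, coeff_bSeries] at h
    exact h.symm

theorem bCoeff_one : bCoeff 1 = MvPolynomial.X 0 := by
  rw [bCoeff_succ]
  simp only [zero_add, Finset.range_one, Finset.sum_singleton, Finset.range_zero,
    Finset.sum_empty, Nat.sub_zero, bCoeff_zero, Derivation.map_one_eq_zero, map_zero]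
  linear_combination MvPolynomial.X 0 * four_inv_cancel

/-! ### Laurent series in `X⁻¹` as a differential field -/

-- Otherwise `HahnSeries.powerSeriesAlgebra` is found, whose scalar action is a different one.
instance : Algebra ℂ InvSeries := HahnSeries.instAlgebra

instance : CharZero InvSeries := charZero_of_injective_ringHom (HahnSeries.C_injective (Γ := ℤ))

theorem coeff_dX (F : InvSeries) (n : ℤ) :
    (dX F).coeff n = -((n - 1 : ℤ) : ℂ) * F.coeff (n - 1) := by
  rw [dX, HahnSeries.coeff_neg, HahnSeries.coeff_single_mul, LaurentSeries.derivative_apply,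
    LaurentSeries.hasseDeriv_coeff, Nat.cast_one, Ring.choose_one_right,
    show n - 2 + 1 = n - 1 by ring, one_mul, zsmul_eq_mul, neg_mul]

theorem coeff_varX_mul_dX (F : InvSeries) (n : ℤ) :
    (varX * dX F).coeff n = -(n : ℂ) * F.coeff n := by
  rw [varX, HahnSeries.coeff_single_mul, coeff_dX, one_mul, sub_neg_eq_add, add_sub_cancel_right]

theorem support_varX_mul_dX_subset (F : InvSeries) : (varX * dX F).support ⊆ F.support := by
  intro n hn h
  exact hn (by rw [coeff_varX_mul_dX, h, mul_zero])

theorem varX_ne_zero : varX ≠ 0 := HahnSeries.single_ne_zero one_ne_zero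

/-- Unlike `∂_X`, the operator `X ∂_X` is diagonal on powers of `X`, so that the Leibniz rule for it
holds term by term. -/
theorem dX_mul (F G : InvSeries) : dX (F * G) = F * dX G + G * dX F := by
  suffices h : varX * dX (F * G) = F * (varX * dX G) + varX * dX F * G from
    mul_left_cancel₀ varX_ne_zero (h.trans (by ring))
  ext n
  rw [coeff_varX_mul_dX, HahnSeries.coeff_add, HahnSeries.coeff_mul,
    HahnSeries.coeff_mul_left' F.isPWO_support (support_varX_mul_dX_subset F),
    HahnSeries.coeff_mul_right' G.isPWO_support (support_varX_mul_dX_subset G),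
    Finset.mul_sum, ← Finset.sum_add_distrib]
  refine Finset.sum_congr rfl fun ij hij => ?_
  have hn : ij.1 + ij.2 = n := by simpa using (Finset.mem_antidiagonal.1 hij).2.2
  rw [coeff_varX_mul_dX, coeff_varX_mul_dX, ← hn]
  push_cast
  ring

/-- `dX` as a derivation. -/
def derX : Derivation ℂ InvSeries InvSeries :=
  Derivation.mk'
    { toFun := dX
      map_add' := fun F G => by
        ext n; simp only [coeff_dX, HahnSeries.coeff_add, mul_add]
      map_smul' := fun a F => by
        ext n; simp only [coeff_dX, HahnSeries.coeff_smul, smul_eq_mul, RingHom.id_apply]; ring }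
    dX_mul

theorem derX_apply (F : InvSeries) : derX F = dX F := rfl

theorem derX_varX : derX varX = 1 := by
  ext n
  rw [derX_apply, coeff_dX, varX, HahnSeries.coeff_one, HahnSeries.coeff_single]
  by_cases h : n = 0
  · simp [h]
  · rw [if_neg (by omega), if_neg h, mul_zero]

theorem eq_zero_of_derX_eq_zero {F : InvSeries} (hF : derX F = 0) (h0 : F.coeff 0 = 0) : F = 0 := by
  ext n
  have h := coeff_varX_mul_dX F n
  rw [← derX_apply, hF, mul_zero, HahnSeries.coeff_zero] at h
  obtain rfl | hn := eq_or_ne n 0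
  · exact h0
  · exact (mul_eq_zero.1 h.symm).resolve_left (by simpa using hn)

/-- `evalJet` as an algebra homomorphism. -/
def evalHom (u : InvSeries) : DiffPoly →ₐ[ℂ] InvSeries := MvPolynomial.aeval fun i => dX^[i] u

theorem evalHom_apply (u : InvSeries) (p : DiffPoly) : evalHom u p = evalJet p u := rfl

theorem evalHom_X (u : InvSeries) (i : ℕ) : evalHom u (MvPolynomial.X i) = dX^[i] u :=
  MvPolynomial.aeval_X _ _

theorem derX_evalHom (u : InvSeries) (p : DiffPoly) :
    derX (evalHom u p) = evalHom u (del p) := by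
  induction p using MvPolynomial.induction_on with
  | C a =>
    rw [← MvPolynomial.algebraMap_eq, AlgHom.commutes, Derivation.map_algebraMap,
      Derivation.map_algebraMap, map_zero]
  | add p q hp hq => rw [map_add, map_add, map_add, map_add, hp, hq]
  | mul_X p i hp =>
    simp only [map_mul, map_add, Derivation.leibniz, smul_eq_mul, hp, evalHom_X, derX_apply, del,
      MvPolynomial.mkDerivation_X, Function.iterate_succ_apply']

/-- The coefficients of the resolvent `b(λ)` of a potential `u`. -/
def resCoeff (u : InvSeries) (k : ℕ) : InvSeries := evalHom u (bCoeff k)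

theorem isLenardSequence_resCoeff (u : InvSeries) : IsLenardSequence derX u (resCoeff u) where
  zero := by rw [resCoeff, bCoeff_zero, map_one]
  succ k := by
    have h := congrArg (evalHom u) (isLenardSequence_bCoeff.succ k)
    simpa only [resCoeff, lenardOp_apply, map_add, map_nsmul, map_mul, ← derX_evalHom, evalHom_X,
      Function.iterate_zero_apply] using h

theorem resCoeff_one (u : InvSeries) : resCoeff u 1 = u := by
  rw [resCoeff, bCoeff_one, evalHom_X, Function.iterate_zero_apply]

theorem resCoeff_succ (u : InvSeries) (k : ℕ) :
    resCoeff u (k + 1) = (1 / 4 : ℂ) •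
      ((∑ i ∈ Finset.range (k + 1),
          (resCoeff u i * derX (derX (resCoeff u (k - i)))
            - (1 / 2 : ℂ) • (derX (resCoeff u i) * derX (resCoeff u (k - i)))
            + 4 • (u * (resCoeff u i * resCoeff u (k - i)))))
        - 2 • ∑ i ∈ Finset.range k, resCoeff u (i + 1) * resCoeff u (k - i)) := by
  rw [resCoeff, bCoeff_succ]
  simp only [MvPolynomial.C_mul', map_smul, map_sub, map_sum, map_add, map_mul, map_ofNat,
    ← derX_evalHom, evalHom_X, Function.iterate_zero_apply, mul_assoc, nsmul_eq_mul,
    Nat.cast_ofNat, resCoeff]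

/-! ### Homogeneous series -/

section Homogeneous

variable (q : ℕ) (s t : ℤ)

/-- The derivation `∂_X` on the coefficients of a homogeneous series of weight `s`. -/
def homDer : PowerSeries ℂ →ₗ[ℂ] PowerSeries ℂ where
  toFun p := PowerSeries.mk fun n => -(q * n + s) * PowerSeries.coeff n p
  map_add' p r := by ext n; simp only [map_add, PowerSeries.coeff_mk]; ring
  map_smul' a p := by
    ext n; simp only [PowerSeries.coeff_smul, PowerSeries.coeff_mk, RingHom.id_apply]; ring

theorem coeff_homDer (p : PowerSeries ℂ) (n : ℕ) :
    PowerSeries.coeff n (homDer q s p) = -(q * n + s) * PowerSeries.coeff n p :=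
  PowerSeries.coeff_mk n fun n => -(q * n + s) * PowerSeries.coeff n p

variable [NeZero q]

/-- The homogeneous series `∑ p_n X^{-(q n + s)}` of weight `s` and step `q`. -/
def homSeries : PowerSeries ℂ →ₗ[ℂ] InvSeries where
  toFun p := HahnSeries.single s 1 *
    HahnSeries.ofPowerSeries ℤ ℂ (PowerSeries.expand q (NeZero.ne q) p)
  map_add' p r := by rw [map_add, map_add, mul_add]
  map_smul' a p := by
    rw [RingHom.id_apply, PowerSeries.smul_eq_C_mul, map_mul, map_mul, PowerSeries.expand_C,
      HahnSeries.ofPowerSeries_C, mul_left_comm, HahnSeries.C_mul_eq_smul]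

theorem homSeries_apply (p : PowerSeries ℂ) : homSeries q s p = HahnSeries.single s 1 *
    HahnSeries.ofPowerSeries ℤ ℂ (PowerSeries.expand q (NeZero.ne q) p) := rfl

theorem coeff_ofPowerSeries_of_neg (p : PowerSeries ℂ) {m : ℤ} (hm : m < 0) :
    (HahnSeries.ofPowerSeries ℤ ℂ p).coeff m = 0 := by
  rw [HahnSeries.ofPowerSeries_apply]
  refine HahnSeries.embDomain_of_notMem_range ?_
  rintro ⟨n, rfl⟩
  exact hm.not_ge (Int.natCast_nonneg n)

theorem coeff_homSeries (p : PowerSeries ℂ) (n : ℕ) :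
    (homSeries q s p).coeff (q * n + s) = PowerSeries.coeff n p := by
  rw [homSeries_apply, HahnSeries.coeff_single_mul, one_mul, add_sub_cancel_right, ← Nat.cast_mul,
    HahnSeries.ofPowerSeries_apply_coeff, PowerSeries.coeff_expand_mul]

theorem coeff_homSeries_of_ne (p : PowerSeries ℂ) {m : ℤ} (hm : ∀ n : ℕ, m ≠ q * n + s) :
    (homSeries q s p).coeff m = 0 := by
  rw [homSeries_apply, HahnSeries.coeff_single_mul, one_mul]
  obtain h | h := lt_or_ge (m - s) 0
  · exact coeff_ofPowerSeries_of_neg _ h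
  · obtain ⟨j, hj⟩ := Int.eq_ofNat_of_zero_le h
    rw [hj, HahnSeries.ofPowerSeries_apply_coeff, PowerSeries.coeff_expand_of_not_dvd]
    rintro ⟨n, rfl⟩
    exact hm n (by push_cast at hj; linarith)

theorem homSeries_injective : Function.Injective (homSeries q s) := by
  intro p r h
  ext n
  rw [← coeff_homSeries q s, h, coeff_homSeries]

theorem homSeries_mul (p r : PowerSeries ℂ) :
    homSeries q s p * homSeries q t r = homSeries q (s + t) (p * r) := by
  have h : (HahnSeries.single (s + t) 1 : InvSeries)
      = HahnSeries.single s 1 * HahnSeries.single t 1 := by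
    rw [HahnSeries.single_mul_single, one_mul]
  rw [homSeries_apply, homSeries_apply, homSeries_apply, map_mul, map_mul, h]
  ring

theorem homSeries_one : homSeries q s 1 = HahnSeries.single s 1 := by
  rw [homSeries_apply, map_one (PowerSeries.expand q _), map_one (HahnSeries.ofPowerSeries ℤ ℂ),
    mul_one]

theorem homSeries_X_mul (p : PowerSeries ℂ) :
    homSeries q s (PowerSeries.X * p) = homSeries q (s + q) p := by
  rw [homSeries_apply, homSeries_apply, map_mul, map_mul, PowerSeries.expand_X,
    HahnSeries.ofPowerSeries_X_pow, ← mul_assoc, HahnSeries.single_mul_single, one_mul]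

theorem derX_homSeries (p : PowerSeries ℂ) :
    derX (homSeries q s p) = homSeries q (s + 1) (homDer q s p) := by
  ext m
  rw [derX_apply, coeff_dX]
  by_cases h : ∃ n : ℕ, m = q * n + (s + 1)
  · obtain ⟨n, rfl⟩ := h
    rw [coeff_homSeries, show (q * n + (s + 1) - 1 : ℤ) = q * n + s by ring, coeff_homSeries,
      coeff_homDer]
    push_cast
    rfl
  · push Not at h
    rw [coeff_homSeries_of_ne q _ _ h, coeff_homSeries_of_ne, mul_zero]
    exact fun n hn => h n (by linarith)

/-- The series of the form `∑ p_n X^{-(q n + s)}`. -/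
def homogeneous : Submodule ℂ InvSeries := LinearMap.range (homSeries q s)

variable {q s t} {F G : InvSeries}

theorem homSeries_mem (p : PowerSeries ℂ) : homSeries q s p ∈ homogeneous q s := ⟨p, rfl⟩

theorem mul_mem_homogeneous (hF : F ∈ homogeneous q s) (hG : G ∈ homogeneous q t) {r : ℤ}
    (hr : s + t = r) : F * G ∈ homogeneous q r := by
  obtain ⟨p, rfl⟩ := hF
  obtain ⟨p', rfl⟩ := hG
  exact ⟨p * p', by rw [homSeries_mul, hr]⟩

theorem derX_mem_homogeneous (hF : F ∈ homogeneous q s) : derX F ∈ homogeneous q (s + 1) := by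
  obtain ⟨p, rfl⟩ := hF
  exact ⟨_, (derX_homSeries q s p).symm⟩

theorem varX_mem_homogeneous : varX ∈ homogeneous q (-1) := ⟨1, homSeries_one q (-1)⟩

theorem one_mem_homogeneous : 1 ∈ homogeneous q 0 := ⟨1, homSeries_one q 0⟩

theorem homogeneous_add_step_le : homogeneous q (s + q) ≤ homogeneous q s := by
  rintro _ ⟨p, rfl⟩
  exact ⟨_, homSeries_X_mul q s p⟩

theorem coeff_zero_of_mem_homogeneous (hs : 0 < s) (hF : F ∈ homogeneous q s) :
    F.coeff 0 = 0 := by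
  obtain ⟨p, rfl⟩ := hF
  exact coeff_homSeries_of_ne q s p fun n => by positivity

theorem homSeries_mk_coeff (hF : F ∈ homogeneous q s) :
    homSeries q s (PowerSeries.mk fun n => F.coeff (q * n + s)) = F := by
  obtain ⟨p, rfl⟩ := hF
  congr 1
  ext n
  rw [PowerSeries.coeff_mk, coeff_homSeries]

theorem resCoeff_mem_homogeneous {u : InvSeries} (hu : u ∈ homogeneous q 2) (k : ℕ) :
    resCoeff u k ∈ homogeneous q (2 * k) := by
  induction k using Nat.strong_induction_on with
  | _ k ih =>
    cases k with
    | zero => exact (isLenardSequence_resCoeff u).zero ▸ one_mem_homogeneous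
    | succ k =>
      rw [resCoeff_succ]
      refine Submodule.smul_mem _ _ (sub_mem (sum_mem fun i hi => ?_)
        (nsmul_mem (sum_mem fun i hi => ?_) _))
      · have hi := Finset.mem_range.1 hi
        have hl := ih i (by omega)
        have hr := ih (k - i) (by omega)
        refine add_mem (sub_mem ?_ (Submodule.smul_mem _ _ ?_)) (nsmul_mem ?_ _)
        · exact mul_mem_homogeneous hl (derX_mem_homogeneous (derX_mem_homogeneous hr)) (by omega)
        · exact mul_mem_homogeneous (derX_mem_homogeneous hl) (derX_mem_homogeneous hr) (by omega)
        · exact mul_mem_homogeneous hu (mul_mem_homogeneous hl hr rfl) (by omega)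
      · have hi := Finset.mem_range.1 hi
        exact mul_mem_homogeneous (ih (i + 1) (by omega)) (ih (k - i) (by omega)) (by omega)

end Homogeneous

/-! ### The coefficients of the resolvent -/

/-- The exponent of `X⁻¹` in the `n`-th term of a homogeneous series of weight `2 k`. -/
def expo (q k n : ℕ) : ℕ := q * n + 2 * k

theorem expo_zero_right (q k : ℕ) : expo q k 0 = 2 * k := by rw [expo, mul_zero, zero_add]

theorem expo_succ (q k n : ℕ) : expo q (k + 1) n = expo q k n + 2 := by rw [expo, expo]; ring

theorem expo_add_expo (q k l i j : ℕ) : expo q k i + expo q l j = expo q (k + l) (i + j) := by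
  rw [expo, expo, expo]; ring

/-- The arrays `β_{k,n}` of coefficients of `b_k = ∑ β_{k,n} X^{-(q n + 2 k)}` for which the `b_k`
form a Lenard sequence with potential `b_1`. -/
structure IsLenardArray {K : Type*} [Semiring K] (q : ℕ) (β : ℕ → ℕ → K) : Prop where
  zero (n : ℕ) : β 0 n = if n = 0 then 1 else 0
  succ (k n : ℕ) : 4 * (expo q k n + 2) * β (k + 1) n =
    expo q k n * (expo q k n + 1) * (expo q k n + 2) * β k n
      + ∑ x ∈ Finset.HasAntidiagonal.antidiagonal n,
          (8 * expo q k x.2 + 4 * expo q 1 x.1) * (β 1 x.1 * β k x.2)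

theorem IsLenardArray.eqOn {K : Type*} [Semiring K] [IsLeftCancelMulZero K] [CharZero K] {q N : ℕ}
    {β γ : ℕ → ℕ → K} (hβ : IsLenardArray q β) (hγ : IsLenardArray q γ)
    (h : ∀ n ≤ N, β 1 n = γ 1 n) (k n : ℕ) (hn : n ≤ N) : β k n = γ k n := by
  induction k generalizing n with
  | zero => rw [hβ.zero, hγ.zero]
  | succ k ih =>
    have hne : (4 * (expo q k n + 2) : K) ≠ 0 := by
      exact_mod_cast Nat.mul_ne_zero four_ne_zero (expo q k n + 1).succ_ne_zero
    refine mul_left_cancel₀ hne ?_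
    rw [hβ.succ, hγ.succ, ih n hn]
    congr 1
    refine Finset.sum_congr rfl fun x hx => ?_
    have hx := Finset.HasAntidiagonal.mem_antidiagonal.1 hx
    rw [h _ (by omega), ih _ (by omega)]

section Row

theorem coeff_homDer_two_mul (q : ℕ) (p : PowerSeries ℂ) (k n : ℕ) :
    PowerSeries.coeff n (homDer q (2 * k) p) = -expo q k n * PowerSeries.coeff n p := by
  rw [coeff_homDer, expo]
  push_cast
  rfl

variable {q : ℕ} [NeZero q]

theorem lenardOp_homSeries (p c : PowerSeries ℂ) (s : ℤ) :
    lenardOp derX (homSeries q 2 p) (homSeries q s c) = homSeries q (s + 1 + 1 + 1)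
      (homDer q (s + 1 + 1) (homDer q (s + 1) (homDer q s c))
        + 8 • (p * homDer q s c) + 4 • (homDer q 2 p * c)) := by
  simp only [lenardOp_apply, derX_homSeries, homSeries_mul, map_add, map_nsmul]
  rw [show 2 + (s + 1) = s + 1 + 1 + 1 by ring, show 2 + 1 + s = s + 1 + 1 + 1 by ring]

variable (q)

/-- The coefficients of the resolvent coefficient `b_k` of the potential `∑ p_n X^{-(q n + 2)}`. -/
def row (p : PowerSeries ℂ) (k : ℕ) : PowerSeries ℂ :=
  PowerSeries.mk fun n => (resCoeff (homSeries q 2 p) k).coeff (q * n + 2 * k)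

variable (p : PowerSeries ℂ)

theorem homSeries_row (k : ℕ) :
    homSeries q (2 * k) (row q p k) = resCoeff (homSeries q 2 p) k :=
  homSeries_mk_coeff (resCoeff_mem_homogeneous (homSeries_mem p) k)

theorem row_zero : row q p 0 = 1 :=
  homSeries_injective q 0 <| by
    rw [homSeries_one]
    exact (homSeries_row q p 0).trans (isLenardSequence_resCoeff _).zero

theorem row_one : row q p 1 = p :=
  homSeries_injective q 2 ((homSeries_row q p 1).trans (resCoeff_one _))

theorem isLenardArray_row : IsLenardArray q fun k n => PowerSeries.coeff n (row q p k) where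
  zero n := by rw [row_zero, PowerSeries.coeff_one]
  succ k n := by
    have h := (isLenardSequence_resCoeff (homSeries q 2 p)).succ k
    rw [← homSeries_row, ← homSeries_row, lenardOp_homSeries, derX_homSeries, ← map_nsmul,
      show (2 * (k + 1 : ℕ) + 1 : ℤ) = 2 * k + 1 + 1 + 1 by push_cast; ring] at h
    have hn := congrArg (PowerSeries.coeff n) (homSeries_injective _ _ h)
    simp only [map_add, map_nsmul] at hn
    simp only [PowerSeries.coeff_mul, coeff_homDer, nsmul_eq_mul] at hn
    have hsum : ∑ x ∈ Finset.HasAntidiagonal.antidiagonal n,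
        (8 * expo q k x.2 + 4 * expo q 1 x.1 : ℂ)
          * (PowerSeries.coeff x.1 p * PowerSeries.coeff x.2 (row q p k)) =
        -(8 * ∑ x ∈ Finset.HasAntidiagonal.antidiagonal n, PowerSeries.coeff x.1 p
            * (-(q * x.2 + 2 * k) * PowerSeries.coeff x.2 (row q p k))
          + 4 * ∑ x ∈ Finset.HasAntidiagonal.antidiagonal n,
            -(q * x.1 + 2) * PowerSeries.coeff x.1 p * PowerSeries.coeff x.2 (row q p k)) := by
      rw [Finset.mul_sum, Finset.mul_sum, ← Finset.sum_add_distrib, ← Finset.sum_neg_distrib]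
      refine Finset.sum_congr rfl fun x _ => ?_
      rw [expo, expo]
      push_cast
      ring
    rw [row_one, hsum, expo]
    push_cast at hn ⊢
    linear_combination -hn

end Row

/-- The array of coefficients `β_{k,n}` of the resolvent of the self-similar potential. -/
def coeffArray (d : ℕ) : ℕ → ℕ → ℝ
  | 0, n => if n = 0 then 1 else 0
  | 1, 0 => 1 / 8
  | 1, n + 1 => 4 ^ d * expo (2 * d + 1) (d + 1) n * coeffArray d (d + 1) n
      / ((2 * d + 1) * (n + 1))
  | k + 2, n =>
    (expo (2 * d + 1) (k + 1) n * (expo (2 * d + 1) (k + 1) n + 1)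
        * (expo (2 * d + 1) (k + 1) n + 2) * coeffArray d (k + 1) n
      + ∑ i : Fin (n + 1),
        (8 * expo (2 * d + 1) (k + 1) (n - i) + 4 * expo (2 * d + 1) 1 i)
          * (coeffArray d 1 i * coeffArray d (k + 1) (n - i)))
      / (4 * (expo (2 * d + 1) (k + 1) n + 2))
termination_by k n => (n, k)
decreasing_by
  · exact Prod.Lex.left _ _ (Nat.lt_succ_self _)
  · exact Prod.Lex.right _ (Nat.lt_succ_self _)
  · rcases (Nat.lt_succ_iff.1 i.2).lt_or_eq with h | h
    · exact Prod.Lex.left _ _ h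
    · rw [h]; exact Prod.Lex.right _ (by omega)
  · rcases (Nat.sub_le n i).lt_or_eq with h | h
    · exact Prod.Lex.left _ _ h
    · rw [h]; exact Prod.Lex.right _ (by omega)

theorem coeffArray_zero (d n : ℕ) : coeffArray d 0 n = if n = 0 then 1 else 0 := by
  rw [coeffArray]

theorem coeffArray_one_zero (d : ℕ) : coeffArray d 1 0 = 1 / 8 := by rw [coeffArray]

theorem coeffArray_one_succ (d n : ℕ) : (2 * d + 1) * (n + 1) * coeffArray d 1 (n + 1) =
    4 ^ d * expo (2 * d + 1) (d + 1) n * coeffArray d (d + 1) n := by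
  rw [coeffArray]
  field_simp

theorem isLenardArray_coeffArray (d : ℕ) : IsLenardArray (2 * d + 1) (coeffArray d) where
  zero := coeffArray_zero d
  succ k n := by
    cases k with
    | zero =>
      rw [Finset.sum_eq_single (n, 0)]
      · rw [coeffArray_zero, coeffArray_zero, expo_zero_right]
        obtain rfl | h := eq_or_ne n 0
        · simp [expo]
        · simp [h, expo]
      · rintro ⟨i, j⟩ hx hne
        have h : i + j = n := Finset.HasAntidiagonal.mem_antidiagonal.1 hx
        have hj : j ≠ 0 := fun hj => hne (by rw [← h, hj, add_zero])
        rw [coeffArray_zero, if_neg hj, mul_zero, mul_zero]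
      · exact fun h => absurd (Finset.HasAntidiagonal.mem_antidiagonal.2 (add_zero n)) h
    | succ k =>
      rw [Finset.Nat.sum_antidiagonal_eq_sum_range_succ_mk, Finset.sum_range, coeffArray]
      exact mul_div_cancel₀ _ (by positivity)

theorem IsLenardArray.map_ofReal {q : ℕ} {β : ℕ → ℕ → ℝ} (hβ : IsLenardArray q β) :
    IsLenardArray q fun k n => (β k n : ℂ) where
  zero n := by rw [hβ.zero, apply_ite Complex.ofReal, Complex.ofReal_one, Complex.ofReal_zero]
  succ k n := by exact_mod_cast congrArg Complex.ofReal (hβ.succ k n)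

/-! ### The self-similar potential -/

/-- The similarity equation `4^d b_{d+1}' = 2 u + X u'`. -/
def IsSelfSimilar (d : ℕ) (u : InvSeries) : Prop :=
  4 ^ d • derX (resCoeff u (d + 1)) = 2 • u + varX * derX u

theorem nsmul_add_varX_mul_derX_homSeries (q : ℕ) [NeZero q] (s : ℕ) (p : PowerSeries ℂ) :
    s • homSeries q s p + varX * derX (homSeries q s p) = homSeries q (s + q)
      (PowerSeries.mk fun n => -(q * (n + 1) * PowerSeries.coeff (n + 1) p)) := by
  have h : s • p + homDer q s p = PowerSeries.X *
      PowerSeries.mk fun n : ℕ => -(q * (n + 1) * PowerSeries.coeff (n + 1) p) := by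
    ext n
    rw [map_add, map_nsmul, coeff_homDer]
    cases n with
    | zero => simp
    | succ n =>
      rw [PowerSeries.coeff_succ_X_mul, PowerSeries.coeff_mk]
      push_cast
      ring
  rw [derX_homSeries, varX, ← homSeries_one q, homSeries_mul, one_mul, ← homSeries_X_mul, ← h,
    map_add, map_nsmul, show (-1 + (s + 1) : ℤ) = s by ring]

theorem isSelfSimilar_homSeries_iff (d : ℕ) (p : PowerSeries ℂ) :
    IsSelfSimilar d (homSeries (2 * d + 1) 2 p) ↔
      ∀ n : ℕ, (2 * d + 1) * (n + 1) * PowerSeries.coeff (n + 1) p =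
        4 ^ d * expo (2 * d + 1) (d + 1) n
          * PowerSeries.coeff n (row (2 * d + 1) p (d + 1)) := by
  have hX := nsmul_add_varX_mul_derX_homSeries (2 * d + 1) 2 p
  rw [Nat.cast_ofNat] at hX
  rw [IsSelfSimilar, hX, ← homSeries_row, derX_homSeries,
    ← map_nsmul, show (2 * (d + 1 : ℕ) + 1 : ℤ) = 2 + (2 * d + 1 : ℕ) by push_cast; ring,
    (homSeries_injective _ _).eq_iff, PowerSeries.ext_iff]
  refine forall_congr' fun n => ?_
  rw [map_nsmul, coeff_homDer_two_mul, PowerSeries.coeff_mk, nsmul_eq_mul]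
  push_cast
  constructor <;> intro h <;> linear_combination h

/-- The `k`-th row of the coefficient array as a power series. -/
def rowSeries (d k : ℕ) : PowerSeries ℂ := PowerSeries.mk fun n => (coeffArray d k n : ℂ)

theorem coeff_rowSeries (d k n : ℕ) :
    PowerSeries.coeff n (rowSeries d k) = (coeffArray d k n : ℂ) := PowerSeries.coeff_mk _ _

theorem row_eq_rowSeries (d k : ℕ) : row (2 * d + 1) (rowSeries d 1) k = rowSeries d k := by
  ext n
  rw [coeff_rowSeries]
  refine (isLenardArray_row _ _).eqOn (isLenardArray_coeffArray d).map_ofReal (fun i _ => ?_) k n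
    le_rfl
  rw [row_one, coeff_rowSeries]

/-- The self-similar potential `u = ∑ β_{1,n} X^{-((2d+1)n+2)}`. -/
def potential (d : ℕ) : InvSeries := homSeries (2 * d + 1) 2 (rowSeries d 1)

theorem potential_mem_homogeneous (d : ℕ) : potential d ∈ homogeneous (2 * d + 1) 2 :=
  homSeries_mem _

theorem resCoeff_potential (d k : ℕ) :
    resCoeff (potential d) k = homSeries (2 * d + 1) (2 * k) (rowSeries d k) := by
  rw [potential, ← homSeries_row, row_eq_rowSeries]

theorem isSelfSimilar_potential (d : ℕ) : IsSelfSimilar d (potential d) := by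
  rw [potential, isSelfSimilar_homSeries_iff]
  intro n
  rw [row_eq_rowSeries, coeff_rowSeries, coeff_rowSeries]
  exact_mod_cast congrArg Complex.ofReal (coeffArray_one_succ d n)

theorem eq_rowSeries_of_isSelfSimilar {d : ℕ} {p : PowerSeries ℂ}
    (h0 : PowerSeries.coeff 0 p = 1 / 8) (hp : IsSelfSimilar d (homSeries (2 * d + 1) 2 p)) :
    p = rowSeries d 1 := by
  rw [isSelfSimilar_homSeries_iff] at hp
  suffices h : ∀ N, ∀ n ≤ N, PowerSeries.coeff n (row (2 * d + 1) p 1) = coeffArray d 1 n by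
    ext n
    rw [coeff_rowSeries, ← h n n le_rfl, row_one]
  intro N
  induction N with
  | zero =>
    intro n hn
    rw [Nat.le_zero.1 hn, row_one, h0, coeffArray_one_zero]
    norm_num
  | succ N ih =>
    intro n hn
    obtain hn | rfl := hn.lt_or_eq
    · exact ih n (Nat.lt_succ_iff.1 hn)
    have hne : ((2 * d + 1) * (N + 1) : ℂ) ≠ 0 := by
      exact_mod_cast Nat.mul_ne_zero (2 * d).succ_ne_zero N.succ_ne_zero
    have key := (isLenardArray_row _ p).eqOn (isLenardArray_coeffArray d).map_ofReal ih (d + 1) N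
      le_rfl
    refine mul_left_cancel₀ hne ?_
    rw [row_one, hp, key]
    exact_mod_cast (congrArg Complex.ofReal (coeffArray_one_succ d N)).symm

/-! ### The merging identity -/

instance : IsAddTorsionFree InvSeries := IsAddTorsionFree.of_isCancelMulZero_charZero

section Wronskian

variable {q : ℕ} [NeZero q]

theorem wronskian_mem_homogeneous {F G : InvSeries} {s t r : ℤ} (hF : F ∈ homogeneous q s)
    (hG : G ∈ homogeneous q t) (hr : s + t + 1 = r) : wronskian derX F G ∈ homogeneous q r :=
  sub_mem (mul_mem_homogeneous hF (derX_mem_homogeneous hG) (by linarith))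
    (mul_mem_homogeneous (derX_mem_homogeneous hF) hG (by linarith))

theorem wronskian_homSeries (p r : PowerSeries ℂ) (s t : ℤ) :
    wronskian derX (homSeries q s p) (homSeries q t r) =
      homSeries q (s + t + 1) (p * homDer q t r - homDer q s p * r) := by
  rw [wronskian, derX_homSeries, derX_homSeries, homSeries_mul, homSeries_mul, map_sub,
    show s + 1 + t = s + t + 1 by ring, add_assoc]

theorem mergingDefect_mem_homogeneous {d : ℕ} {u : InvSeries} (hu : u ∈ homogeneous (2 * d + 1) 2)
    (k : ℕ) : mergingDefect derX varX (resCoeff u) d k ∈ homogeneous (2 * d + 1) (2 * k) := by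
  have hB := resCoeff_mem_homogeneous hu
  refine sub_mem (add_mem (nsmul_mem (hB k) _) ?_) (nsmul_mem (sum_mem fun j hj => ?_) _)
  · exact mul_mem_homogeneous varX_mem_homogeneous (derX_mem_homogeneous (hB k)) (by ring)
  · have hj := Finset.mem_range.1 hj
    exact homogeneous_add_step_le (wronskian_mem_homogeneous (hB j) (hB (k + d - j)) (by omega))

end Wronskian

theorem mergingDefect_eq_zero {d : ℕ} {u : InvSeries} (hu : u ∈ homogeneous (2 * d + 1) 2)
    (h : IsSelfSimilar d u) (k : ℕ) : mergingDefect derX varX (resCoeff u) d k = 0 := by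
  have hB := isLenardSequence_resCoeff u
  induction k with
  | zero => exact mergingDefect_zero hB.zero d
  | succ k ih =>
    have hT := hB.lenardOp_mergingDefect derX_varX h k
    rw [ih, map_zero, eq_comm, smul_eq_zero_iff_right four_ne_zero] at hT
    exact eq_zero_of_derX_eq_zero hT
      (coeff_zero_of_mem_homogeneous (by positivity) (mergingDefect_mem_homogeneous hu (k + 1)))

theorem coeff_wronskian_rowSeries (d j l n : ℕ) : PowerSeries.coeff n
    (rowSeries d j * homDer (2 * d + 1) (2 * l) (rowSeries d l)
      - homDer (2 * d + 1) (2 * j) (rowSeries d j) * rowSeries d l) =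
    (-∑ x ∈ Finset.HasAntidiagonal.antidiagonal n,
      ((expo (2 * d + 1) l x.2 : ℝ) - expo (2 * d + 1) j x.1)
        * (coeffArray d j x.1 * coeffArray d l x.2) : ℝ) := by
  rw [map_sub, PowerSeries.coeff_mul, PowerSeries.coeff_mul, ← Finset.sum_sub_distrib,
    ← Finset.sum_neg_distrib, Complex.ofReal_sum]
  refine Finset.sum_congr rfl fun x _ => ?_
  rw [coeff_homDer_two_mul, coeff_homDer_two_mul, coeff_rowSeries, coeff_rowSeries]
  push_cast
  ring

theorem wronskian_resCoeff_potential (d j l : ℕ) {s : ℤ} (hs : 2 * j + 2 * l + 1 = s) :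
    wronskian derX (resCoeff (potential d) j) (resCoeff (potential d) l) =
      homSeries (2 * d + 1) s (rowSeries d j * homDer (2 * d + 1) (2 * l) (rowSeries d l)
        - homDer (2 * d + 1) (2 * j) (rowSeries d j) * rowSeries d l) := by
  rw [resCoeff_potential, resCoeff_potential, wronskian_homSeries, hs]

theorem coeffArray_merging (d k n : ℕ) : (2 * d + 1) * (n + 1) * coeffArray d k (n + 1) =
    4 ^ d * ∑ j ∈ Finset.range (d + 1), ∑ x ∈ Finset.HasAntidiagonal.antidiagonal n,
      ((expo (2 * d + 1) (k + d - j) x.2 : ℝ) - expo (2 * d + 1) j x.1)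
        * (coeffArray d j x.1 * coeffArray d (k + d - j) x.2) := by
  have hW : ∀ j ∈ Finset.range (d + 1), 2 * (j : ℤ) + 2 * (k + d - j : ℕ) + 1
      = 2 * k + (2 * d + 1 : ℕ) := fun j hj => by
    have hj := Finset.mem_range.1 hj
    omega
  have hk := nsmul_add_varX_mul_derX_homSeries (2 * d + 1) (2 * k) (rowSeries d k)
  rw [Nat.cast_mul, Nat.cast_ofNat, ← resCoeff_potential] at hk
  have h := mergingDefect_eq_zero (potential_mem_homogeneous d) (isSelfSimilar_potential d) k
  rw [mergingDefect, sub_eq_zero, hk, wronskianSum, Finset.sum_congr rfl fun j hj =>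
    wronskian_resCoeff_potential d j _ (hW j hj), ← map_sum, ← map_nsmul] at h
  have hn := congrArg (PowerSeries.coeff n) (homSeries_injective _ _ h)
  rw [PowerSeries.coeff_mk, map_nsmul, map_sum, coeff_rowSeries,
    Finset.sum_congr rfl fun j _ => coeff_wronskian_rowSeries d j _ n, ← Complex.ofReal_sum,
    Finset.sum_neg_distrib, nsmul_eq_mul] at hn
  apply Complex.ofReal_injective
  push_cast at hn ⊢
  linear_combination -hn

/-! ### The formal solution -/

/-- The potential `u = (V_X - V²)/2` of the Painlevé II hierarchy. -/
def miura (V : InvSeries) : InvSeries := HahnSeries.C (1 / 2) * (derX V - V ^ 2)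

theorem two_mul_C_half : (2 : InvSeries) * HahnSeries.C (1 / 2) = 1 := by
  rw [← map_ofNat HahnSeries.C 2, ← map_mul, mul_one_div_cancel two_ne_zero, map_one]

theorem two_nsmul_miura (V : InvSeries) : 2 • miura V = derX V - V ^ 2 := by
  rw [miura, nsmul_eq_mul, Nat.cast_ofNat, ← mul_assoc, two_mul_C_half, one_mul]

/-- The series `X - 4^d b_d`: with `u = (V_X - V²)/2`, the Painlevé II equation says that it is
annihilated by `∂_X + 2 V`. -/
def riccatiSeries (d : ℕ) (u : InvSeries) : InvSeries := varX - 4 ^ d • resCoeff u d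

theorem evalJet_m (u : InvSeries) (d : ℕ) :
    evalJet (m d) u = (1 / (2 * d + 1)‼ : ℂ) • resCoeff u (d + 1) := by
  rw [← evalHom_apply, m, MvPolynomial.C_mul', map_smul, resCoeff]

theorem p2Lhs_one_half {d : ℕ} (hd : 1 ≤ d) (V : InvSeries) : p2Lhs d (1 / 2) V =
    HahnSeries.C (-(1 / 2)) * (derX (riccatiSeries d (miura V))
      + 2 • (V * riccatiSeries d (miura V))) := by
  obtain ⟨d, rfl⟩ := Nat.exists_eq_add_of_le' hd
  have hfac : ((2 * d + 1)‼ : ℂ) ≠ 0 := by exact_mod_cast (Nat.doubleFactorial_pos _).ne'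
  have hscale : ((2 : ℂ) ^ (2 * (d + 1) - 1) * (2 * (d + 1) - 1)‼) * (1 / (2 * d + 1)‼) =
      1 / 2 * 4 ^ (d + 1) := by
    rw [show 2 * (d + 1) - 1 = 2 * d + 1 by omega, mul_assoc, mul_one_div_cancel hfac, pow_succ,
      pow_mul, pow_succ]
    norm_num
    ring
  have hm := congrArg (HahnSeries.C (Γ := ℤ)) hscale
  rw [map_mul, map_mul _ (1 / 2), map_pow, map_ofNat] at hm
  rw [p2Lhs, Nat.add_sub_cancel, ← derX_apply, ← derX_apply, ← miura, evalJet_m,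
    Derivation.map_smul, ← HahnSeries.C_mul_eq_smul, ← HahnSeries.C_mul_eq_smul,
    riccatiSeries, map_sub, map_nsmul, derX_varX, map_neg]
  linear_combination (derX (resCoeff (miura V) (d + 1)) + 2 * V * resCoeff (miura V) (d + 1)) * hm
    + V * varX * two_mul_C_half

theorem lenardOp_riccatiSeries (d : ℕ) (u : InvSeries) :
    lenardOp derX u (riccatiSeries d u) =
      4 • (2 • u + varX * derX u - 4 ^ d • derX (resCoeff u (d + 1))) := by
  have hX : lenardOp derX u varX = 4 • (2 • u + varX * derX u) := by
    rw [lenardOp_apply, derX_varX, Derivation.map_one_eq_zero, map_zero]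
    ring
  rw [riccatiSeries, map_sub, map_nsmul, hX, ← (isLenardSequence_resCoeff u).succ]
  ring

theorem isSelfSimilar_iff_lenardOp_riccatiSeries (d : ℕ) (u : InvSeries) :
    IsSelfSimilar d u ↔ lenardOp derX u (riccatiSeries d u) = 0 := by
  rw [lenardOp_riccatiSeries, smul_eq_zero_iff_right four_ne_zero, sub_eq_zero, eq_comm,
    IsSelfSimilar]

theorem isSelfSimilar_miura {d : ℕ} {V : InvSeries}
    (h : derX (riccatiSeries d (miura V)) + 2 • (V * riccatiSeries d (miura V)) = 0) :
    IsSelfSimilar d (miura V) := by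
  have hform := lenardForm_of_riccati derX h (miura V)
  rw [two_nsmul_miura, sub_self, mul_zero, smul_zero] at hform
  have hprod := map_lenardForm derX (miura V) (riccatiSeries d (miura V))
  rw [hform, map_zero, eq_comm, smul_eq_zero_iff_right two_ne_zero, mul_eq_zero] at hprod
  rw [isSelfSimilar_iff_lenardOp_riccatiSeries]
  obtain hR | hker := hprod
  · rw [hR, map_zero]
  · exact hker

/-- The coefficients of `X - 4^d b_d` for the self-similar potential. -/
def riccatiCoeffs (d : ℕ) : PowerSeries ℂ := 1 - PowerSeries.X * 4 ^ d • rowSeries d d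

theorem coeff_zero_riccatiCoeffs (d : ℕ) : PowerSeries.coeff 0 (riccatiCoeffs d) = 1 := by
  rw [riccatiCoeffs, map_sub, PowerSeries.coeff_zero_X_mul, PowerSeries.coeff_zero_one, sub_zero]

theorem coeff_succ_riccatiCoeffs (d n : ℕ) :
    PowerSeries.coeff (n + 1) (riccatiCoeffs d) = -(4 ^ d * coeffArray d d n : ℝ) := by
  rw [riccatiCoeffs, map_sub, PowerSeries.coeff_succ_X_mul, map_nsmul, coeff_rowSeries,
    PowerSeries.coeff_one, if_neg n.succ_ne_zero, zero_sub, nsmul_eq_mul]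
  push_cast
  rfl

theorem riccatiCoeffs_ne_zero (d : ℕ) : riccatiCoeffs d ≠ 0 := fun h => by
  have h1 := coeff_zero_riccatiCoeffs d
  rw [h, map_zero] at h1
  exact zero_ne_one h1

theorem riccatiSeries_potential (d : ℕ) :
    riccatiSeries d (potential d) = homSeries (2 * d + 1) (-1) (riccatiCoeffs d) := by
  rw [riccatiCoeffs, map_sub, homSeries_one, homSeries_X_mul, map_nsmul, riccatiSeries,
    resCoeff_potential, varX]
  congr 4
  push_cast
  ring

theorem lenardForm_homSeries {q : ℕ} [NeZero q] (p c : PowerSeries ℂ) (s : ℤ) :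
    lenardForm derX (homSeries q 2 p) (homSeries q s c) = homSeries q (2 * s + 2)
      (2 • (c * homDer q (s + 1) (homDer q s c)) - homDer q s c ^ 2 + 8 • (p * c ^ 2)) := by
  simp only [lenardForm, derX_homSeries, sq, homSeries_mul, map_add, map_sub, map_nsmul]
  rw [show s + (s + 1 + 1) = 2 * s + 2 by ring, show s + 1 + (s + 1) = 2 * s + 2 by ring,
    show 2 + (s + s) = 2 * s + 2 by ring]

theorem lenardForm_riccatiSeries_potential (d : ℕ) :
    lenardForm derX (potential d) (riccatiSeries d (potential d)) = 0 := by
  have hder : derX (lenardForm derX (potential d) (riccatiSeries d (potential d))) = 0 := by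
    rw [map_lenardForm,
      (isSelfSimilar_iff_lenardOp_riccatiSeries d _).1 (isSelfSimilar_potential d), mul_zero,
      smul_zero]
  refine eq_zero_of_derX_eq_zero hder ?_
  rw [riccatiSeries_potential, potential, lenardForm_homSeries]
  refine (coeff_homSeries (2 * d + 1) (2 * (-1) + 2) _ 0).trans ?_
  simp only [sq, map_add, map_sub, map_nsmul, PowerSeries.coeff_mul, Finset.Nat.antidiagonal_zero,
    Finset.sum_singleton, coeff_homDer, coeff_rowSeries, coeffArray_one_zero,
    coeff_zero_riccatiCoeffs]
  norm_num

theorem ansatz_eq_homSeries (d : ℕ) (v : ℕ → ℂ) :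
    ansatz d v = homSeries (2 * d + 1) 1 (-PowerSeries.mk v) := by
  rw [map_neg, ansatz, map_neg, map_mul, HahnSeries.ofPowerSeries_X, homSeries_apply]

theorem riccati_ansatz_eq_zero_iff (d : ℕ) (v : ℕ → ℂ) :
    derX (riccatiSeries d (potential d)) + 2 • (ansatz d v * riccatiSeries d (potential d)) = 0 ↔
      2 • (PowerSeries.mk v * riccatiCoeffs d)
        = homDer (2 * d + 1) (-1) (riccatiCoeffs d) := by
  rw [ansatz_eq_homSeries, riccatiSeries_potential, derX_homSeries, homSeries_mul, ← map_nsmul,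
    neg_add_cancel, add_neg_cancel, ← map_add, map_eq_zero_iff _ (homSeries_injective _ _), neg_mul,
    smul_neg, ← sub_eq_add_neg, sub_eq_zero, eq_comm]

theorem miura_ansatz (d : ℕ) (v : ℕ → ℂ) :
    miura (ansatz d v) = homSeries (2 * d + 1) 2 ((-(1 / 2) : ℂ) •
      (homDer (2 * d + 1) 1 (PowerSeries.mk v) + PowerSeries.mk v ^ 2)) := by
  rw [miura, HahnSeries.C_mul_eq_smul, ansatz_eq_homSeries, derX_homSeries, sq, homSeries_mul,
    one_add_one_eq_two, ← map_sub, ← map_smul, map_neg, neg_mul_neg, ← sq, neg_smul, ← smul_neg,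
    neg_add']

theorem miura_ansatz_eq_potential {d : ℕ} {v : ℕ → ℂ} (h0 : v 0 = 1 / 2)
    (h : IsSelfSimilar d (miura (ansatz d v))) : miura (ansatz d v) = potential d := by
  rw [miura_ansatz] at h ⊢
  rw [eq_rowSeries_of_isSelfSimilar _ h, potential]
  rw [PowerSeries.coeff_smul, map_add, coeff_homDer, sq, PowerSeries.coeff_mul,
    Finset.Nat.antidiagonal_zero, Finset.sum_singleton, PowerSeries.coeff_mk, h0]
  norm_num

theorem miura_eq_potential {d : ℕ} {V : InvSeries}
    (h : derX (riccatiSeries d (potential d)) + 2 • (V * riccatiSeries d (potential d)) = 0) :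
    miura V = potential d := by
  have hR : riccatiSeries d (potential d) ≠ 0 := by
    rw [riccatiSeries_potential, ← map_zero (homSeries (2 * d + 1) (-1)),
      (homSeries_injective _ _).ne_iff]
    exact riccatiCoeffs_ne_zero d
  have hform := lenardForm_of_riccati derX h (potential d)
  rw [lenardForm_riccatiSeries_potential, eq_comm, smul_eq_zero_iff_right four_ne_zero,
    mul_eq_zero_iff_left (pow_ne_zero 2 hR), sub_eq_zero, ← two_nsmul_miura] at hform
  exact (nsmul_right_injective two_ne_zero hform).symm

theorem isFormalSolution_iff {d : ℕ} (hd : 1 ≤ d) (v : ℕ → ℂ) : IsFormalSolution d v ↔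
    2 • (PowerSeries.mk v * riccatiCoeffs d) = homDer (2 * d + 1) (-1) (riccatiCoeffs d) := by
  rw [← riccati_ansatz_eq_zero_iff, IsFormalSolution, p2Lhs_one_half hd,
    mul_eq_zero_iff_left (HahnSeries.C_ne_zero (by norm_num))]
  constructor
  · rintro ⟨h0, h⟩
    rwa [miura_ansatz_eq_potential h0 (isSelfSimilar_miura h)] at h
  · intro h
    refine ⟨?_, by rwa [miura_eq_potential h]⟩
    have hcoeff := congrArg (PowerSeries.coeff 0) ((riccati_ansatz_eq_zero_iff d v).1 h)
    rw [map_nsmul, PowerSeries.coeff_mul, Finset.Nat.antidiagonal_zero, Finset.sum_singleton,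
      PowerSeries.coeff_mk, coeff_homDer, coeff_zero_riccatiCoeffs, nsmul_eq_mul] at hcoeff
    push_cast at hcoeff
    linear_combination hcoeff / 2

theorem existsUnique_isFormalSolution {d : ℕ} (hd : 1 ≤ d) : ∃! v, IsFormalSolution d v := by
  have hinv : PowerSeries.constantCoeff (riccatiCoeffs d) ≠ 0 := by
    rw [← PowerSeries.coeff_zero_eq_constantCoeff_apply, coeff_zero_riccatiCoeffs]
    exact one_ne_zero
  obtain ⟨w, hw⟩ : ∃ w, ∀ p, 2 • (p * riccatiCoeffs d) =
      homDer (2 * d + 1) (-1) (riccatiCoeffs d) ↔ p = w := by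
    have hhalf : (2 : PowerSeries ℂ) * PowerSeries.C (1 / 2) = 1 := by
      rw [← map_ofNat PowerSeries.C 2, ← map_mul, mul_one_div_cancel two_ne_zero, map_one]
    refine ⟨PowerSeries.C (1 / 2) * homDer (2 * d + 1) (-1) (riccatiCoeffs d)
      * (riccatiCoeffs d)⁻¹, fun p => ?_⟩
    rw [PowerSeries.eq_mul_inv_iff_mul_eq hinv, nsmul_eq_mul, Nat.cast_ofNat]
    constructor <;> intro h
    · linear_combination (-p * riccatiCoeffs d) * hhalf + PowerSeries.C (1 / 2) * h
    · linear_combination 2 * h + homDer (2 * d + 1) (-1) (riccatiCoeffs d) * hhalf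
  refine ⟨fun n => PowerSeries.coeff n w, (isFormalSolution_iff hd _).2 ((hw _).2 ?_),
    fun v hv => funext fun n => ?_⟩
  · exact PowerSeries.ext fun n => PowerSeries.coeff_mk _ _
  · rw [← (hw _).1 ((isFormalSolution_iff hd v).1 hv), PowerSeries.coeff_mk]

theorem IsFormalSolution.apply_succ {d : ℕ} (hd : 1 ≤ d) {v : ℕ → ℂ} (hv : IsFormalSolution d v)
    (n : ℕ) : v (n + 1) =
      (((2 * d + 1) * (n + 1) / 2 * (4 ^ d * coeffArray d d n) : ℝ) : ℂ)
        + ∑ i ∈ Finset.range n, v (i + 1) * (4 ^ d * coeffArray d d (n - 1 - i) : ℝ) := by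
  have h := congrArg (PowerSeries.coeff (n + 1)) ((isFormalSolution_iff hd v).1 hv)
  have hsum : ∑ i ∈ Finset.range n, v (i + 1) * PowerSeries.coeff (n - i) (riccatiCoeffs d) =
      -∑ i ∈ Finset.range n, v (i + 1) * (4 ^ d * coeffArray d d (n - 1 - i) : ℝ) := by
    rw [← Finset.sum_neg_distrib]
    refine Finset.sum_congr rfl fun i hi => ?_
    have hi := Finset.mem_range.1 hi
    rw [show n - i = n - 1 - i + 1 by omega, coeff_succ_riccatiCoeffs]
    push_cast
    ring
  rw [map_nsmul, PowerSeries.coeff_mul, Finset.Nat.sum_antidiagonal_eq_sum_range_succ_mk,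
    Finset.sum_range_succ, Finset.sum_range_succ'] at h
  simp only [Nat.add_sub_add_right, PowerSeries.coeff_mk] at h
  rw [hsum, coeff_homDer, Nat.sub_self, Nat.sub_zero, coeff_zero_riccatiCoeffs,
    coeff_succ_riccatiCoeffs, hv.1, nsmul_eq_mul] at h
  push_cast at h ⊢
  linear_combination h / 2

/-! ### Normalized coefficients -/

open Filter Topology

theorem coeffArray_nonneg (d k n : ℕ) : 0 ≤ coeffArray d k n := by
  fun_induction coeffArray d k n with
  | case1 => exact zero_le_one
  | case2 => exact le_rfl
  | case3 => positivity
  | case4 => positivity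
  | case5 k n ih ih_one ih_row =>
    have := Finset.sum_nonneg fun (i : Fin (n + 1)) (_ : i ∈ Finset.univ) =>
      mul_nonneg (by positivity :
        (0 : ℝ) ≤ 8 * expo (2 * d + 1) (k + 1) (n - i) + 4 * expo (2 * d + 1) 1 i)
        (mul_nonneg (ih_one i) (ih_row i))
    positivity

/-- The expected size `((2d+1)n + 2k)! / ((2d+1)^n n!)` of `4^k β_{k,n}`, up to a factor
`(2d+1)n + 2k`. -/
def growth (d k n : ℕ) : ℝ := (expo (2 * d + 1) k n)! / ((2 * d + 1) ^ n * n !)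

theorem growth_pos (d k n : ℕ) : 0 < growth d k n := by rw [growth]; positivity

theorem growth_succ_left (d k n : ℕ) : growth d (k + 1) n =
    (expo (2 * d + 1) k n + 2) * (expo (2 * d + 1) k n + 1) * growth d k n := by
  rw [growth, growth, expo_succ, Nat.factorial_succ, Nat.factorial_succ]
  push_cast
  ring

theorem expo_succ_right (d k n : ℕ) :
    expo (2 * d + 1) k (n + 1) = expo (2 * d + 1) (k + d) n + 1 := by
  rw [expo, expo]
  ring

theorem growth_succ_right (d k n : ℕ) : (2 * d + 1) * (n + 1) * growth d k (n + 1) =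
    expo (2 * d + 1) k (n + 1) * growth d (k + d) n := by
  rw [growth, growth, expo_succ_right, Nat.factorial_succ, Nat.factorial_succ]
  push_cast
  field_simp
  ring

/-- The factor relating a product of two expected sizes to the expected size of a product. -/
def growthRatio (d k l i j : ℕ) : ℝ := growth d k i * growth d l j / growth d (k + l) (i + j)

theorem growthRatio_nonneg (d k l i j : ℕ) : 0 ≤ growthRatio d k l i j :=
  div_nonneg (mul_nonneg (growth_pos d k i).le (growth_pos d l j).le) (growth_pos d _ _).le

theorem growth_mul_growth (d k l i j : ℕ) : growth d k i * growth d l j =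
    growthRatio d k l i j * growth d (k + l) (i + j) :=
  (div_mul_cancel₀ _ (growth_pos d _ _).ne').symm

theorem growthRatio_mul_choose (d k l i j : ℕ) : growthRatio d k l i j *
    (expo (2 * d + 1) (k + l) (i + j)).choose (expo (2 * d + 1) k i) = (i + j).choose i := by
  rw [← expo_add_expo, Nat.cast_add_choose, Nat.cast_add_choose, growthRatio, growth, growth,
    growth, ← expo_add_expo, pow_add]
  field_simp

theorem choose_mul_choose_le (a b i j : ℕ) : a.choose i * b.choose j ≤ (a + b).choose (i + j) := by
  rw [Nat.add_choose_eq]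
  exact Finset.single_le_sum (f := fun x : ℕ × ℕ => a.choose x.1 * b.choose x.2)
    (fun _ _ => Nat.zero_le _) (Finset.HasAntidiagonal.mem_antidiagonal.2 rfl : (i, j) ∈ _)

theorem choose_le_choose_of_add_le {N r s : ℕ} (hr : r ≤ s) (hs : s + r ≤ N) :
    N.choose r ≤ N.choose s := by
  have main : ∀ s, r ≤ s → 2 * s ≤ N → N.choose r ≤ N.choose s := fun s hr => by
    induction s, hr using Nat.le_induction with
    | base => exact fun _ => le_rfl
    | succ s _ ih =>
      exact fun hs => (ih (by omega)).trans (Nat.choose_le_succ_of_lt_half_left (by omega))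
  obtain h | h := le_total (2 * s) N
  · exact main s hr h
  · rw [← Nat.choose_symm (by omega : s ≤ N)]
    exact main (N - s) (by omega) (by omega)

theorem growthRatio_le {d k l i j r : ℕ} (hi : r ≤ 2 * (d * i + k)) (hj : r ≤ 2 * (d * j + l)) :
    growthRatio d k l i j ≤ 1 / (2 * (d * (i + j) + (k + l))).choose r := by
  set N := 2 * (d * (i + j) + (k + l)) with hN
  have hsum : N = 2 * (d * i + k) + 2 * (d * j + l) := by rw [hN]; ring
  have hpos : 0 < N.choose r := Nat.choose_pos (by omega)
  have hnat : (i + j).choose i * N.choose r ≤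
      (expo (2 * d + 1) (k + l) (i + j)).choose (expo (2 * d + 1) k i) := by
    have h := choose_mul_choose_le (i + j) N i (2 * (d * i + k))
    rw [show expo (2 * d + 1) (k + l) (i + j) = i + j + N by rw [expo, hN]; ring,
      show expo (2 * d + 1) k i = i + 2 * (d * i + k) by rw [expo]; ring]
    exact (Nat.mul_le_mul_left _ (choose_le_choose_of_add_le hi (by omega))).trans h
  have hch : 0 < (expo (2 * d + 1) (k + l) (i + j)).choose (expo (2 * d + 1) k i) :=
    Nat.choose_pos (by rw [← expo_add_expo]; omega)
  have hch' : (0 : ℝ) < (expo (2 * d + 1) (k + l) (i + j)).choose (expo (2 * d + 1) k i) := by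
    exact_mod_cast hch
  rw [le_div_iff₀ (by exact_mod_cast hpos)]
  refine le_of_mul_le_mul_right ?_ hch'
  rw [mul_right_comm, growthRatio_mul_choose, one_mul]
  exact_mod_cast hnat

/-- The coefficients `β_{k,n}` divided by their expected size. -/
def normArray (d k n : ℕ) : ℝ :=
  expo (2 * d + 1) k n * (4 ^ k * coeffArray d k n) / growth d k n

theorem normArray_nonneg (d k n : ℕ) : 0 ≤ normArray d k n := by
  have := coeffArray_nonneg d k n
  have := growth_pos d k n
  rw [normArray]
  positivity

theorem expo_ne_zero {q k : ℕ} (hk : k ≠ 0) (n : ℕ) : (expo q k n : ℝ) ≠ 0 := by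
  rw [Nat.cast_ne_zero, expo]
  omega

theorem pow_mul_coeffArray {k : ℕ} (hk : k ≠ 0) (d n : ℕ) :
    4 ^ k * coeffArray d k n = normArray d k n * growth d k n / expo (2 * d + 1) k n := by
  rw [normArray, div_mul_cancel₀ _ (growth_pos d k n).ne',
    mul_div_cancel_left₀ _ (expo_ne_zero hk n)]

theorem pow_mul_coeffArray_mul_coeffArray {k l : ℕ} (hk : k ≠ 0) (hl : l ≠ 0) (d i j : ℕ)
    (u v : ℝ) : 4 ^ (k + l) * ((u * expo (2 * d + 1) l j + v * expo (2 * d + 1) k i)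
      * (coeffArray d k i * coeffArray d l j)) =
    (u / expo (2 * d + 1) k i + v / expo (2 * d + 1) l j) * growthRatio d k l i j
      * (normArray d k i * normArray d l j) * growth d (k + l) (i + j) := by
  have ha := expo_ne_zero (q := 2 * d + 1) hk i
  have hb := expo_ne_zero (q := 2 * d + 1) hl j
  calc _ = (u * expo (2 * d + 1) l j + v * expo (2 * d + 1) k i)
        * ((4 ^ k * coeffArray d k i) * (4 ^ l * coeffArray d l j)) := by ring
    _ = (u / expo (2 * d + 1) k i + v / expo (2 * d + 1) l j)
        * (normArray d k i * normArray d l j) * (growth d k i * growth d l j) := by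
      rw [pow_mul_coeffArray hk, pow_mul_coeffArray hl]
      field_simp
    _ = _ := by rw [growth_mul_growth]; ring

theorem normArray_succ_left {k : ℕ} (hk : k ≠ 0) (d n : ℕ) : normArray d (k + 1) n =
    normArray d k n + ∑ x ∈ Finset.HasAntidiagonal.antidiagonal n,
      (2 / expo (2 * d + 1) 1 x.1 + 1 / expo (2 * d + 1) k x.2)
        * growthRatio d 1 k x.1 x.2 * (normArray d 1 x.1 * normArray d k x.2) := by
  have hG := (growth_pos d (k + 1) n).ne'
  have hterm : ∀ x ∈ Finset.HasAntidiagonal.antidiagonal n,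
      4 ^ k * ((8 * expo (2 * d + 1) k x.2 + 4 * expo (2 * d + 1) 1 x.1) *
        (coeffArray d 1 x.1 * coeffArray d k x.2)) =
      (2 / expo (2 * d + 1) 1 x.1 + 1 / expo (2 * d + 1) k x.2) * growthRatio d 1 k x.1 x.2
        * (normArray d 1 x.1 * normArray d k x.2) * growth d (k + 1) n := fun x hx => by
    have h := pow_mul_coeffArray_mul_coeffArray one_ne_zero hk d x.1 x.2 2 1
    rw [Finset.HasAntidiagonal.mem_antidiagonal.1 hx, add_comm 1 k, pow_succ] at h
    linear_combination h
  refine mul_right_cancel₀ hG ?_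
  rw [add_mul, Finset.sum_mul, ← Finset.sum_congr rfl hterm, ← Finset.mul_sum]
  have hrec := (isLenardArray_coeffArray d).succ k n
  have hk' := growth_succ_left d k n
  rw [normArray, div_mul_cancel₀ _ hG, hk', expo_succ, normArray, pow_succ]
  have hG' := (growth_pos d k n).ne'
  generalize (Finset.sum _ _ : ℝ) = S at hrec ⊢
  push_cast
  field_simp
  linear_combination hrec

theorem coeffArray_succ_right (d k n : ℕ) :
    (2 * d + 1) * (n + 1) * coeffArray d k (n + 1) =
      4 ^ d * (expo (2 * d + 1) (k + d) n * coeffArray d (k + d) n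
        + ∑ j ∈ Finset.range d, ∑ x ∈ Finset.HasAntidiagonal.antidiagonal n,
          ((expo (2 * d + 1) (k + d - (j + 1)) x.2 : ℝ) - expo (2 * d + 1) (j + 1) x.1)
            * (coeffArray d (j + 1) x.1 * coeffArray d (k + d - (j + 1)) x.2)) := by
  rw [coeffArray_merging, Finset.sum_range_succ', add_comm, Nat.sub_zero,
    Finset.sum_eq_single (0, n)]
  · rw [coeffArray_zero, if_pos rfl, expo_zero_right, mul_zero, Nat.cast_zero, sub_zero, one_mul]
  · rintro ⟨i, j⟩ hx hne
    have hi : i ≠ 0 := by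
      rintro rfl
      exact hne (by rw [← Finset.HasAntidiagonal.mem_antidiagonal.1 hx, zero_add])
    rw [coeffArray_zero, if_neg hi, zero_mul, mul_zero]
  · exact fun h => absurd (Finset.HasAntidiagonal.mem_antidiagonal.2 (zero_add n)) h

theorem normArray_succ_right {k : ℕ} (hk : k ≠ 0) (d n : ℕ) : normArray d k (n + 1) =
    normArray d (k + d) n + ∑ j ∈ Finset.range d, ∑ x ∈ Finset.HasAntidiagonal.antidiagonal n,
      (1 / expo (2 * d + 1) (j + 1) x.1 - 1 / expo (2 * d + 1) (k + d - (j + 1)) x.2)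
        * growthRatio d (j + 1) (k + d - (j + 1)) x.1 x.2
        * (normArray d (j + 1) x.1 * normArray d (k + d - (j + 1)) x.2) := by
  have hterm : ∀ j ∈ Finset.range d, ∀ x ∈ Finset.HasAntidiagonal.antidiagonal n,
      4 ^ (k + d) * (((expo (2 * d + 1) (k + d - (j + 1)) x.2 : ℝ) - expo (2 * d + 1) (j + 1) x.1)
        * (coeffArray d (j + 1) x.1 * coeffArray d (k + d - (j + 1)) x.2)) =
      (1 / expo (2 * d + 1) (j + 1) x.1 - 1 / expo (2 * d + 1) (k + d - (j + 1)) x.2)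
        * growthRatio d (j + 1) (k + d - (j + 1)) x.1 x.2
        * (normArray d (j + 1) x.1 * normArray d (k + d - (j + 1)) x.2)
        * growth d (k + d) n := fun j hj x hx => by
    have hj := Finset.mem_range.1 hj
    obtain ⟨l, hl⟩ : ∃ l, j + 1 + l = k + d := ⟨k + d - (j + 1), by omega⟩
    have h := pow_mul_coeffArray_mul_coeffArray j.succ_ne_zero (by omega : l ≠ 0) d x.1 x.2 1 (-1)
    rw [Finset.HasAntidiagonal.mem_antidiagonal.1 hx, hl] at h
    rw [← hl, Nat.add_sub_cancel_left, hl]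
    linear_combination h
  have hG := (growth_pos d (k + d) n).ne'
  have hrec := coeffArray_succ_right d k n
  have hg := growth_succ_right d k n
  refine mul_right_cancel₀ hG ?_
  simp only [add_mul, Finset.sum_mul]
  rw [Finset.sum_congr rfl fun j hj => (Finset.sum_congr rfl (hterm j hj)).symm]
  simp only [← Finset.mul_sum]
  generalize (Finset.sum _ _ : ℝ) = S at hrec ⊢
  rw [normArray, div_mul_eq_mul_div, div_eq_iff (growth_pos d k (n + 1)).ne', normArray,
    div_mul_cancel₀ _ hG]
  refine mul_left_cancel₀ (by positivity : ((2 * d + 1) * (n + 1) : ℝ) ≠ 0) ?_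
  linear_combination (expo (2 * d + 1) k (n + 1) * 4 ^ k * growth d (k + d) n) * hrec
    - (4 ^ (k + d) * (expo (2 * d + 1) (k + d) n * coeffArray d (k + d) n + S)) * hg

/-! ### Limits of the normalized coefficients -/

theorem sq_le_choose_two (P : ℕ) : P ^ 2 ≤ (2 * P).choose 2 := by
  have h := Nat.choose_succ_right_eq (2 * P) 1
  rw [Nat.choose_one_right] at h
  obtain _ | P := P
  · exact Nat.zero_le _
  · rw [show 2 * (P + 1) - 1 = 2 * P + 1 by omega] at h
    nlinarith

theorem mul_choose_two_le {n P : ℕ} (h : n + 2 ≤ P) :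
    2 * (n + 1) * (2 * P).choose 2 ≤ 3 * (2 * P).choose 3 := by
  have hsucc := Nat.choose_succ_right_eq (2 * P) 2
  exact (Nat.mul_le_mul_right _ (by omega : 2 * (n + 1) ≤ 2 * P - 2)).trans (by linarith)

theorem growthRatio_le_of_mem_antidiagonal {d k l n r : ℕ} {x : ℕ × ℕ}
    (hx : x ∈ Finset.HasAntidiagonal.antidiagonal n) (h₁ : r ≤ 2 * (d * x.1 + k))
    (h₂ : r ≤ 2 * (d * x.2 + l)) :
    growthRatio d k l x.1 x.2 ≤ 1 / (2 * (d * n + (k + l))).choose r := by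
  rw [← Finset.HasAntidiagonal.mem_antidiagonal.1 hx]
  exact growthRatio_le h₁ h₂

theorem sum_growthRatio_boundary_le {k l : ℕ} (d : ℕ) (hk : k ≠ 0) (hl : l ≠ 0) (n : ℕ) :
    ∑ x ∈ Finset.HasAntidiagonal.antidiagonal n with x.1 = 0 ∨ x.2 = 0,
      growthRatio d k l x.1 x.2 ≤ 2 * (1 / (2 * (d * n + (k + l))).choose 2) := by
  have hcard : ((Finset.HasAntidiagonal.antidiagonal n).filter
      fun x => x.1 = 0 ∨ x.2 = 0).card ≤ 2 := by
    refine (Finset.card_le_card (t := {(0, n), (n, 0)}) fun x hx => ?_).trans Finset.card_le_two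
    simp only [Finset.mem_filter, Finset.HasAntidiagonal.mem_antidiagonal] at hx
    simp only [Finset.mem_insert, Finset.mem_singleton, Prod.ext_iff]
    omega
  refine (Finset.sum_le_card_nsmul _ _ (1 / ((2 * (d * n + (k + l))).choose 2 : ℝ)) fun x hx =>
    growthRatio_le_of_mem_antidiagonal (Finset.mem_filter.1 hx).1 (by omega) (by omega)).trans ?_
  rw [nsmul_eq_mul]
  gcongr
  exact_mod_cast hcard

theorem sum_growthRatio_interior_le {d k l : ℕ} (hd : 1 ≤ d) (hk : k ≠ 0) (hl : l ≠ 0) (n : ℕ) :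
    ∑ x ∈ Finset.HasAntidiagonal.antidiagonal n with ¬(x.1 = 0 ∨ x.2 = 0),
      growthRatio d k l x.1 x.2 ≤ (n + 1) * (1 / (2 * (d * n + (k + l))).choose 3) := by
  refine (Finset.sum_le_card_nsmul _ _ (1 / ((2 * (d * n + (k + l))).choose 3 : ℝ))
    fun x hx => ?_).trans ?_
  · obtain ⟨hx, hne⟩ := Finset.mem_filter.1 hx
    rw [not_or] at hne
    have h₁ := Nat.mul_pos hd (Nat.pos_of_ne_zero hne.1)
    have h₂ := Nat.mul_pos hd (Nat.pos_of_ne_zero hne.2)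
    exact growthRatio_le_of_mem_antidiagonal hx (by omega) (by omega)
  · have hcard := Finset.card_filter_le (Finset.HasAntidiagonal.antidiagonal n)
      fun x => ¬(x.1 = 0 ∨ x.2 = 0)
    rw [Finset.Nat.card_antidiagonal] at hcard
    rw [nsmul_eq_mul]
    gcongr
    exact_mod_cast hcard

/-- Only the two boundary terms are of order `P⁻²`, where `P = d n + k + l`; each of the at most
`n + 1` interior terms is of order `P⁻³`. -/
theorem sum_growthRatio_le {d k l : ℕ} (hd : 1 ≤ d) (hk : k ≠ 0) (hl : l ≠ 0) (n : ℕ) :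
    ∑ x ∈ Finset.HasAntidiagonal.antidiagonal n, growthRatio d k l x.1 x.2 ≤
      4 / (n + (k + l)) ^ 2 := by
  set P := d * n + (k + l)
  have hnP : n + (k + l) ≤ P := Nat.add_le_add_right (Nat.le_mul_of_pos_left n hd) _
  have hP : n + 2 ≤ P := (by omega : n + 2 ≤ n + (k + l)).trans hnP
  have hsq : (P : ℝ) ^ 2 ≤ (2 * P).choose 2 := by exact_mod_cast sq_le_choose_two P
  have hcubic : 2 * (n + 1) * ((2 * P).choose 2 : ℝ) ≤ 3 * (2 * P).choose 3 := by
    exact_mod_cast mul_choose_two_le hP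
  have hpos : ∀ r ≤ 3, (0 : ℝ) < (2 * P).choose r := fun r hr => by
    exact_mod_cast Nat.choose_pos (by omega)
  rw [← Finset.sum_filter_add_sum_filter_not _ fun x : ℕ × ℕ => x.1 = 0 ∨ x.2 = 0]
  calc _ ≤ 2 * (1 / ((2 * P).choose 2 : ℝ)) + (n + 1) * (1 / (2 * P).choose 3) :=
        add_le_add (sum_growthRatio_boundary_le d hk hl n)
          (sum_growthRatio_interior_le hd hk hl n)
    _ ≤ 2 * (1 / ((2 * P).choose 2 : ℝ)) + 2 * (1 / (2 * P).choose 2) := by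
        refine add_le_add le_rfl ?_
        rw [mul_one_div, mul_one_div, div_le_div_iff₀ (hpos 3 le_rfl) (hpos 2 (by omega))]
        linarith [hpos 3 le_rfl]
    _ = 4 / (2 * P).choose 2 := by ring
    _ ≤ 4 / (n + (k + l)) ^ 2 := by
        gcongr
        refine le_trans ?_ hsq
        gcongr
        exact_mod_cast hnP

theorem one_div_natCast_le_one (n : ℕ) : 1 / (n : ℝ) ≤ 1 :=
  (one_div (n : ℝ)).trans_le n.cast_inv_le_one

theorem abs_normArray_succ_right_sub_le {d k n : ℕ} (hd : 1 ≤ d) (hk : k ≠ 0)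
    (h : ∀ l, ∀ m ≤ n, normArray d l m ≤ 1) :
    |normArray d k (n + 1) - normArray d (k + d) n| ≤ 4 * d / (n + (k + d)) ^ 2 := by
  have hweight : ∀ a b : ℕ, |1 / (a : ℝ) - 1 / b| ≤ 1 := fun a b =>
    abs_sub_le_of_nonneg_of_le a.one_div_cast_nonneg (one_div_natCast_le_one a)
      b.one_div_cast_nonneg (one_div_natCast_le_one b)
  rw [normArray_succ_right hk, add_sub_cancel_left]
  refine (Finset.abs_sum_le_sum_abs _ _).trans ?_
  refine (Finset.sum_le_card_nsmul _ _ (4 / ((n : ℝ) + (k + d)) ^ 2) fun j hj => ?_).trans_eq ?_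
  · have hj := Finset.mem_range.1 hj
    have hsum := sum_growthRatio_le hd j.succ_ne_zero (by omega : k + d - (j + 1) ≠ 0) n
    rw [← Nat.cast_add (j + 1), show j + 1 + (k + d - (j + 1)) = k + d by omega, Nat.cast_add]
      at hsum
    refine ((Finset.abs_sum_le_sum_abs _ _).trans (Finset.sum_le_sum fun x hx => ?_)).trans hsum
    have hx := Finset.HasAntidiagonal.mem_antidiagonal.1 hx
    have hg : normArray d (j + 1) x.1 * normArray d (k + d - (j + 1)) x.2 ≤ 1 :=
      mul_le_one₀ (h _ _ (by omega)) (normArray_nonneg _ _ _) (h _ _ (by omega))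
    rw [abs_mul, abs_mul, abs_of_nonneg (growthRatio_nonneg _ _ _ _ _),
      abs_of_nonneg (mul_nonneg (normArray_nonneg _ _ _) (normArray_nonneg _ _ _))]
    exact (mul_le_of_le_one_right (mul_nonneg (abs_nonneg _) (growthRatio_nonneg _ _ _ _ _))
      hg).trans (mul_le_of_le_one_left (growthRatio_nonneg _ _ _ _ _) (hweight _ _))
  · rw [Finset.card_range, nsmul_eq_mul]
    ring

theorem normArray_zero_left (d n : ℕ) : normArray d 0 n = 0 := by
  rw [normArray, coeffArray_zero]
  obtain rfl | hn := eq_or_ne n 0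
  · rw [expo_zero_right, mul_zero, Nat.cast_zero, zero_mul, zero_div]
  · rw [if_neg hn, mul_zero, mul_zero, zero_div]

theorem monotone_normArray (d n : ℕ) : Monotone fun k => normArray d k n := by
  refine monotone_nat_of_le_succ fun k => ?_
  obtain rfl | hk := eq_or_ne k 0
  · rw [normArray_zero_left]
    exact normArray_nonneg _ _ _
  · rw [normArray_succ_left hk]
    refine le_add_of_nonneg_right (Finset.sum_nonneg fun x _ => ?_)
    have := growthRatio_nonneg d 1 k x.1 x.2
    have := normArray_nonneg d 1 x.1
    have := normArray_nonneg d k x.2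
    positivity

theorem normArray_zero_right (d k : ℕ) : normArray d (k + 1) 0 =
    2 * (k + 1) / (2 * (k + 1) + 1) / Real.Wallis.W (k + 1) := by
  induction k with
  | zero =>
    rw [normArray, coeffArray_one_zero, growth, expo_zero_right, Real.Wallis.W_succ]
    norm_num [Real.Wallis.W]
  | succ k ih =>
    have hratio : growthRatio d 1 (k + 1) 0 0 = 1 / ((k + 2) * (2 * k + 3)) := by
      have h := growthRatio_mul_choose d 1 (k + 1) 0 0
      rw [expo_zero_right, expo_zero_right, mul_one, Nat.cast_choose_two, Nat.choose_self] at h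
      rw [eq_div_iff (by positivity)]
      push_cast at h
      linear_combination h
    rw [normArray_succ_left k.succ_ne_zero, Finset.Nat.antidiagonal_zero, Finset.sum_singleton,
      hratio, ih, Real.Wallis.W_succ (k + 1)]
    have hone : normArray d 1 0 = 1 / 2 := by
      rw [normArray, coeffArray_one_zero, growth, expo_zero_right]
      norm_num
    have hW := (Real.Wallis.W_pos (k + 1)).ne'
    rw [hone, expo_zero_right, expo_zero_right]
    push_cast
    field_simp
    ring

theorem tendsto_normArray_zero_right (d : ℕ) :
    Tendsto (fun k => normArray d k 0) atTop (𝓝 (2 / Real.pi)) := by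
  rw [← tendsto_add_atTop_iff_nat 1]
  have hratio : Tendsto (fun k : ℕ => 2 * ((k : ℝ) + 1) / (2 * (k + 1) + 1)) atTop (𝓝 1) := by
    have h := tendsto_natCast_div_add_atTop (1 / 2 : ℝ)
    refine ((tendsto_add_atTop_iff_nat 1).2 h).congr fun k => ?_
    push_cast
    field_simp
  have hW := Real.Wallis.tendsto_W_nhds_pi_div_two.comp (tendsto_add_atTop_nat 1)
  have h := hratio.div hW (by positivity)
  rw [one_div_div] at h
  exact h.congr fun k => (normArray_zero_right d k).symm

theorem normArray_le_of_tendsto {d n : ℕ}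
    (h : Tendsto (fun k => normArray d k n) atTop (𝓝 (2 / Real.pi))) (k : ℕ) :
    normArray d k n ≤ 1 :=
  ((monotone_normArray d n).ge_of_tendsto h k).trans
    ((div_le_one Real.pi_pos).2 Real.two_le_pi)

theorem tendsto_normArray_row {d : ℕ} (hd : 1 ≤ d) (n : ℕ) :
    Tendsto (fun k => normArray d k n) atTop (𝓝 (2 / Real.pi)) := by
  induction n using Nat.strong_induction_on with
  | _ n ih =>
    obtain _ | n := n
    · exact tendsto_normArray_zero_right d
    have hsub : Tendsto (fun k => normArray d k (n + 1) - normArray d (k + d) n) atTop (𝓝 0) := by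
      refine squeeze_zero_norm' (a := fun k : ℕ => 4 * d / (k : ℝ)) ?_
        (tendsto_const_div_atTop_nhds_zero_nat _)
      filter_upwards [eventually_ne_atTop 0] with k hk
      refine (abs_normArray_succ_right_sub_le hd hk fun l m hm =>
        normArray_le_of_tendsto (ih m (Nat.lt_succ_of_le hm)) l).trans ?_
      gcongr
      have : (1 : ℝ) ≤ k := by exact_mod_cast Nat.pos_of_ne_zero hk
      have : (0 : ℝ) ≤ n + d := by positivity
      nlinarith
    have h := hsub.add ((tendsto_add_atTop_iff_nat d).2 (ih n n.lt_succ_self))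
    rw [zero_add] at h
    exact h.congr fun k => sub_add_cancel _ _

theorem normArray_le_one {d : ℕ} (hd : 1 ≤ d) (k n : ℕ) : normArray d k n ≤ 1 :=
  normArray_le_of_tendsto (tendsto_normArray_row hd n) k

theorem abs_normArray_sub_zero_right_le {d : ℕ} (hd : 1 ≤ d) {N : ℕ} (hN : 0 < N) (n : ℕ) {k : ℕ}
    (hk : k ≠ 0) (h : N ≤ n + k) :
    |normArray d k n - normArray d (k + n * d) 0| ≤ n * (4 * d / N ^ 2) := by
  induction n generalizing k with
  | zero => simp
  | succ n ih =>
    have hstep := (abs_normArray_succ_right_sub_le (n := n) hd hk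
      fun l m _ => normArray_le_one hd l m).trans
      (by gcongr; exact_mod_cast (by omega : N ≤ n + (k + d)) : _ ≤ 4 * (d : ℝ) / N ^ 2)
    have htail := ih (k := k + d) (by omega) (by omega)
    rw [show k + d + n * d = k + (n + 1) * d by ring] at htail
    push_cast
    linarith [abs_sub_le (normArray d k (n + 1)) (normArray d (k + d) n)
      (normArray d (k + (n + 1) * d) 0)]

/-- `normArray d d n` is compared with `normArray d (d + n d) 0` by `n` merging steps, each of
which costs `O(n⁻²)`. -/
theorem tendsto_normArray_diag {d : ℕ} (hd : 1 ≤ d) :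
    Tendsto (fun n => normArray d d n) atTop (𝓝 (2 / Real.pi)) := by
  have hsub : Tendsto (fun n => normArray d d n - normArray d (d + n * d) 0) atTop (𝓝 0) := by
    refine squeeze_zero_norm' (a := fun n : ℕ => 4 * d / (n : ℝ)) ?_
      (tendsto_const_div_atTop_nhds_zero_nat _)
    filter_upwards [eventually_gt_atTop 0] with n hn
    refine (abs_normArray_sub_zero_right_le hd hn n (by omega) (n.le_add_right d)).trans_eq ?_
    field_simp
  have hrow : Tendsto (fun n => normArray d (d + n * d) 0) atTop (𝓝 (2 / Real.pi)) :=
    (tendsto_normArray_zero_right d).comp (tendsto_atTop_mono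
      (fun n => (Nat.le_mul_of_pos_right n hd).trans (Nat.le_add_left _ _)) tendsto_id)
  have h := hsub.add hrow
  rw [zero_add] at h
  exact h.congr fun n => sub_add_cancel _ _

/-! ### Asymptotics of the formal solution -/

theorem growth_add_le (d k n : ℕ) : growth d (k + d) n ≤ growth d k (n + 1) := by
  have hexpo : ((2 * d + 1) * (n + 1) : ℝ) ≤ expo (2 * d + 1) k (n + 1) := by
    exact_mod_cast Nat.le_add_right _ _
  have hpos : (0 : ℝ) < (2 * d + 1) * (n + 1) := by positivity
  refine le_of_mul_le_mul_left ?_ hpos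
  rw [growth_succ_right]
  exact mul_le_mul_of_nonneg_right hexpo (growth_pos _ _ _).le

theorem growth_mul_growth_le {d : ℕ} (hd : 1 ≤ d) (i j : ℕ) :
    growth d d i * growth d d j ≤ growth d d (i + j + 1) / (i + j + 2) ^ 2 := by
  set P := d * (i + j) + (d + d) with hP
  have hle : i + j + 2 ≤ P := by nlinarith
  have hsq : ((i + j + 2 : ℝ)) ^ 2 ≤ (2 * P).choose 2 := by
    exact_mod_cast (Nat.pow_le_pow_left hle 2).trans (sq_le_choose_two P)
  calc growth d d i * growth d d j
      = growthRatio d d d i j * growth d (d + d) (i + j) := growth_mul_growth ..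
    _ ≤ 1 / (2 * P).choose 2 * growth d d (i + j + 1) :=
      mul_le_mul (growthRatio_le (by omega) (by omega)) (growth_add_le d d (i + j))
        (growth_pos _ _ _).le (by positivity)
    _ ≤ 1 / (i + j + 2) ^ 2 * growth d d (i + j + 1) := by
      have := (growth_pos d d (i + j + 1)).le
      gcongr
    _ = growth d d (i + j + 1) / (i + j + 2) ^ 2 := one_div_mul_eq_div _ _

theorem pow_mul_coeffArray_le_growth {d : ℕ} (hd : 1 ≤ d) (n : ℕ) :
    4 ^ d * coeffArray d d n ≤ growth d d n := by
  have hd0 : d ≠ 0 := by omega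
  have hg := (growth_pos d d n).le
  rw [pow_mul_coeffArray hd0, div_eq_mul_one_div]
  exact (mul_le_of_le_one_right (mul_nonneg (normArray_nonneg d d n) hg)
    (one_div_natCast_le_one _)).trans (mul_le_of_le_one_left hg (normArray_le_one hd d n))

/-- The inhomogeneous term of the recursion for `v_{n+1}`, which determines its asymptotics. -/
def leading (d n : ℕ) : ℝ := (2 * d + 1) * (n + 1) / 2 * (4 ^ d * coeffArray d d n)

theorem leading_eq {d : ℕ} (hd : 1 ≤ d) (n : ℕ) : leading d n =
    normArray d d n / 2 * (1 + 1 / expo (2 * d + 1) d n) * growth d d n := by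
  have hd0 : d ≠ 0 := by omega
  have hexpo := expo_ne_zero (q := 2 * d + 1) hd0 n
  have hlin : ((2 * d + 1) * (n + 1) : ℝ) = expo (2 * d + 1) d n + 1 := by
    rw [expo]
    push_cast
    ring
  rw [leading, hlin, pow_mul_coeffArray hd0]
  field_simp

theorem leading_nonneg (d n : ℕ) : 0 ≤ leading d n := by
  have := coeffArray_nonneg d d n
  rw [leading]
  positivity

theorem leading_le {d : ℕ} (hd : 1 ≤ d) (n : ℕ) : leading d n ≤ growth d d n := by
  rw [leading_eq hd]
  refine mul_le_of_le_one_left (growth_pos d d n).le ?_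
  have hexpo := one_div_natCast_le_one (expo (2 * d + 1) d n)
  have := normArray_nonneg d d n
  calc normArray d d n / 2 * (1 + 1 / expo (2 * d + 1) d n) ≤ 1 / 2 * (1 + 1) := by
        gcongr
        exact normArray_le_one hd d n
    _ = 1 := by norm_num

theorem tendsto_leading_div {d : ℕ} (hd : 1 ≤ d) :
    Tendsto (fun n => leading d n / growth d d n) atTop (𝓝 (1 / Real.pi)) := by
  have hexpo : Tendsto (fun n => 1 / (expo (2 * d + 1) d n : ℝ)) atTop (𝓝 0) :=
    tendsto_const_nhds.div_atTop (tendsto_natCast_atTop_atTop.comp (tendsto_atTop_mono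
      (fun n => (Nat.le_mul_of_pos_left n (Nat.succ_pos _)).trans (Nat.le_add_right _ _))
      tendsto_id))
  have h := ((tendsto_normArray_diag hd).div_const 2).mul (hexpo.const_add 1)
  rw [show 2 / Real.pi / 2 * (1 + 0) = 1 / Real.pi by ring] at h
  refine h.congr fun n => ?_
  rw [leading_eq hd, mul_div_cancel_right₀ _ (growth_pos d d n).ne']

theorem IsFormalSolution.norm_sub_leading_le_of_norm_le {d : ℕ} (hd : 1 ≤ d) {v : ℕ → ℂ}
    (hv : IsFormalSolution d v) {n : ℕ} (h : ∀ i < n, ‖v (i + 1)‖ ≤ 2 * growth d d i) :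
    ‖v (n + 1) - leading d n‖ ≤ 2 * n / (n + 1) ^ 2 * growth d d n := by
  have hterm : ∀ i ∈ Finset.range n, ‖v (i + 1) * ((4 ^ d * coeffArray d d (n - 1 - i) : ℝ) : ℂ)‖
      ≤ 2 * (growth d d n / (n + 1) ^ 2) := fun i hi => by
    obtain ⟨j, rfl⟩ := Nat.exists_eq_add_of_lt (Finset.mem_range.1 hi)
    have hβ : 0 ≤ 4 ^ d * coeffArray d d j := mul_nonneg (by positivity) (coeffArray_nonneg d d j)
    rw [show i + j + 1 - 1 - i = j by omega, norm_mul, Complex.norm_real, Real.norm_of_nonneg hβ]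
    calc _ ≤ 2 * growth d d i * growth d d j :=
          mul_le_mul (h i (by omega)) (pow_mul_coeffArray_le_growth hd j) hβ
            (mul_nonneg zero_le_two (growth_pos d d i).le)
      _ ≤ 2 * (growth d d (i + j + 1) / (i + j + 2) ^ 2) := by
          rw [mul_assoc]
          exact mul_le_mul_of_nonneg_left (growth_mul_growth_le hd i j) zero_le_two
      _ = _ := by
          push_cast
          ring
  rw [hv.apply_succ hd, leading, add_sub_cancel_left]
  refine (norm_sum_le_of_le _ hterm).trans_eq ?_
  rw [Finset.sum_const, Finset.card_range, nsmul_eq_mul]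
  ring

theorem IsFormalSolution.norm_apply_succ_le {d : ℕ} (hd : 1 ≤ d) {v : ℕ → ℂ}
    (hv : IsFormalSolution d v) (n : ℕ) : ‖v (n + 1)‖ ≤ 2 * growth d d n := by
  induction n using Nat.strong_induction_on with
  | _ n ih =>
    have hfrac : 2 * (n : ℝ) / (n + 1) ^ 2 ≤ 1 := by
      rw [div_le_one (by positivity)]
      nlinarith
    calc ‖v (n + 1)‖ ≤ ‖v (n + 1) - leading d n‖ + ‖(leading d n : ℂ)‖ := norm_le_norm_sub_add _ _
      _ ≤ 1 * growth d d n + growth d d n := by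
        refine add_le_add ((hv.norm_sub_leading_le_of_norm_le hd ih).trans
          (mul_le_mul_of_nonneg_right hfrac (growth_pos d d n).le)) ?_
        rw [Complex.norm_real, Real.norm_of_nonneg (leading_nonneg d n)]
        exact leading_le hd n
      _ = 2 * growth d d n := by ring

theorem IsFormalSolution.tendsto_sub_leading_div {d : ℕ} (hd : 1 ≤ d) {v : ℕ → ℂ}
    (hv : IsFormalSolution d v) :
    Tendsto (fun n => (v (n + 1) - leading d n) / (growth d d n : ℂ)) atTop (𝓝 0) := by
  have hbound := (tendsto_one_div_add_atTop_nhds_zero_nat (𝕜 := ℝ)).const_mul 2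
  rw [mul_zero] at hbound
  refine squeeze_zero_norm (fun n => ?_) hbound
  have hg := growth_pos d d n
  rw [norm_div, Complex.norm_real, Real.norm_of_nonneg hg.le, div_le_iff₀ hg]
  refine (hv.norm_sub_leading_le_of_norm_le hd fun i _ => hv.norm_apply_succ_le hd i).trans ?_
  refine mul_le_mul_of_nonneg_right ?_ hg.le
  rw [mul_one_div, div_le_div_iff₀ (by positivity) (by positivity)]
  nlinarith

theorem IsFormalSolution.tendsto_div_growth {d : ℕ} (hd : 1 ≤ d) {v : ℕ → ℂ}
    (hv : IsFormalSolution d v) :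
    Tendsto (fun n => v (n + 1) / (growth d d n : ℂ)) atTop (𝓝 (1 / Real.pi)) := by
  have hlead := (Complex.continuous_ofReal.tendsto _).comp (tendsto_leading_div hd)
  have h := (hv.tendsto_sub_leading_div hd).add hlead
  rw [zero_add, Complex.ofReal_div, Complex.ofReal_one] at h
  refine h.congr fun n => ?_
  rw [Function.comp_apply, Complex.ofReal_div, ← add_div, sub_add_cancel]

theorem growth_self_eq (d n : ℕ) : (growth d d n : ℂ) =
    ((2 * d + 1) * (n + 1) - 1)! / (((2 * d + 1 : ℕ) : ℂ) ^ n * n !) := by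
  rw [growth, expo, show (2 * d + 1) * (n + 1) - 1 = (2 * d + 1) * n + 2 * d by
    rw [mul_add]
    omega]
  push_cast
  rfl

theorem IsFormalSolution.isEquivalent {d : ℕ} (hd : 1 ≤ d) {v : ℕ → ℂ}
    (hv : IsFormalSolution d v) :
    Asymptotics.IsEquivalent atTop v fun n : ℕ => 1 / (Real.pi : ℂ) *
      (((2 * d + 1) * n - 1)! / (((2 * d + 1 : ℕ) : ℂ) ^ (n - 1) * (n - 1)!)) := by
  have hpi : (Real.pi : ℂ) ≠ 0 := by exact_mod_cast Real.pi_ne_zero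
  refine Asymptotics.isEquivalent_of_tendsto_one ((tendsto_add_atTop_iff_nat 1).1 ?_)
  have h := (hv.tendsto_div_growth hd).mul_const (Real.pi : ℂ)
  rw [one_div_mul_cancel hpi] at h
  refine h.congr fun n => ?_
  rw [Pi.div_apply, Nat.add_sub_cancel, ← growth_self_eq, one_div_mul_eq_div, div_div_eq_mul_div,
    div_mul_eq_mul_div]

end PainleveII

end

theorem theorem1p3 (d : ℕ) (hd : 1 ≤ d) :
    ∃ v : ℕ → ℂ, PainleveII.IsFormalSolution d v ∧
      (∀ w : ℕ → ℂ, PainleveII.IsFormalSolution d w → w = v) ∧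
      Asymptotics.IsEquivalent Filter.atTop v (fun n : ℕ =>
        1 / (Real.pi : ℂ) * ((((2 * d + 1) * n - 1).factorial : ℂ) /
          (((2 * d + 1 : ℕ) : ℂ) ^ (n - 1) * ((n - 1).factorial : ℂ)))) := by
  obtain ⟨v, hv, hunique⟩ := PainleveII.existsUnique_isFormalSolution hd
  exact ⟨v, hv, hunique, hv.isEquivalent hd⟩
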